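/- Let $(X_i)_{i\ge 1}$ be a sequence of independent real random variables with absolutely continuous densities $p_{X_i}$, with $\mathbb E X_i=0$ and $\left(\int_{\mathbb R}|p_{X_i}'|\right)^2<J$ for all $i$. Put $B_n=\sum_{i=1}^n \mathrm{Var}(X_i)$ and $S_n=(X_1+\cdots+X_n)/\sqrt{B_n}$, and for a real random variable $Y$ let $D(Y)$ be the Kullback--Leibler divergence of the law of $Y$ from the Gaussian law with the same mean and variance as $Y$. There is a constant $C=C(J,M)>0$, depending only on $J$ and $M$, such that the following hold. (a) Let $k_0\ge 3$ be real and let $\varepsilon\in(0,\tfrac12)$ with $\varepsilon<1-\tfrac{2}{k_0}$. There is a constant $C_1=C_1(\varepsilon,k_0)>0$, depending only on $\varepsilon$ and $k_0$, such that for every real $k\ge k_0$ with $\mathbb E|X_i|^k\le M$ for all $i$, and for every $n\ge1$, $$D(S_n)\le C_1\left(\frac{\mathbb E\left|\sum_{i=1}^n X_i\right|^k}{B_n^{k/2}}\right)^{2/k}\left(C\,\frac{\sum_{i=1}^n\mathbb E|X_i|^3}{B_n^{3/2}}\right)^{1-\frac2k-\varepsilon}.$$ (In particular $k_0=k$ may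 be taken; and with $k_0=4$ the constant $C_1$ depends only on $\varepsilon$, for all $k\ge4$ and all $\varepsilon\in(0,\frac12)$.) (b) For every $\varepsilon\in(0,\tfrac12)$ there is a constant $C_1=C_1(\varepsilon)>0$, depending only on $\varepsilon$, such that, if $\mathbb E|X_i|^4\le M$ for all $i$, then for every $n\ge1$, $$D(S_n)\le C_1\left(C\,\frac{\sum_{i=1}^n\mathbb E|X_i|^3}{B_n^{3/2}}\right)^{\frac12-\varepsilon}\sqrt{\frac{\sum_{i=1}^n\mathbb E|X_i|^4}{B_n^{2}}+3}.$$ -/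

import Mathlib

open MeasureTheory ProbabilityTheory

universe u

noncomputable section

namespace EntropicCLT

/-- `p` is an absolutely continuous probability density (with respect to Lebesgue measure) of the
real random variable `X` on the probability space `(Ω, P)`. -/
structure IsACDensity {Ω : Type*} [MeasurableSpace Ω] (P : Measure Ω) (X : Ω → ℝ) (p : ℝ → ℝ) :
    Prop where
  nonneg : ∀ x, 0 ≤ p x
  absolutelyContinuous : ∀ a b : ℝ, AbsolutelyContinuousOnInterval p a b
  map_eq : P.map X = volume.withDensity (fun x => ENNReal.ofReal (p x))

/-- An independent sequence of centered random variables with absolutely continuous densities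
`p i` such that `(∫ |p i'|) ^ 2 < J` for all `i`. -/
structure IsCenteredSequence {Ω : Type*} [MeasurableSpace Ω] (P : Measure Ω)
    (X : ℕ → Ω → ℝ) (p : ℕ → ℝ → ℝ) (J : ℝ) : Prop where
  measurable : ∀ i, Measurable (X i)
  indep : iIndepFun X P
  centered : ∀ i, ∫ ω, X i ω ∂P = 0
  density : ∀ i, IsACDensity P (X i) (p i)
  integrable_deriv : ∀ i, Integrable (deriv (p i))
  deriv_lt : ∀ i, (∫ x, |deriv (p i) x|) ^ 2 < J

/-- `E |X i| ^ k` is finite and at most `M`, for all `i`. -/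
def MomentBound {Ω : Type*} [MeasurableSpace Ω] (P : Measure Ω)
    (X : ℕ → Ω → ℝ) (k M : ℝ) : Prop :=
  ∀ i, Integrable (fun ω => |X i ω| ^ k) P ∧ ∫ ω, |X i ω| ^ k ∂P ≤ M

/-- `B_n`, the sum of the variances of the first `n` variables. -/
def sumVar {Ω : Type*} [MeasurableSpace Ω] (P : Measure Ω) (X : ℕ → Ω → ℝ) (n : ℕ) : ℝ :=
  ∑ i ∈ Finset.range n, variance (X i) P

/-- `S_n = (X_1 + ⋯ + X_n) / √B_n`. -/
def normSum {Ω : Type*} [MeasurableSpace Ω] (P : Measure Ω) (X : ℕ → Ω → ℝ) (n : ℕ) : Ω → ℝ :=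
  fun ω => (∑ i ∈ Finset.range n, X i ω) / √(sumVar P X n)

/-- `D(Y)`: the Kullback-Leibler divergence of the law of `Y` from the Gaussian law with the
same mean and variance. -/
def divGaussian {Ω : Type*} [MeasurableSpace Ω] (P : Measure Ω) (Y : Ω → ℝ) : ENNReal :=
  InformationTheory.klDiv (P.map Y) (gaussianReal (∫ ω, Y ω ∂P) (variance Y P).toNNReal)

/-- The Lyapunov ratio `L_s = (∑_{i ≤ n} E |X_i| ^ s) / B_n ^ (s / 2)`. -/
def lyapunov {Ω : Type*} [MeasurableSpace Ω] (P : Measure Ω) (X : ℕ → Ω → ℝ) (s : ℝ) (n : ℕ) :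
    ℝ :=
  (∑ i ∈ Finset.range n, ∫ ω, |X i ω| ^ s ∂P) / sumVar P X n ^ (s / 2)

/-- The normalized `k`-th absolute moment of the sum, `E |X_1 + ⋯ + X_n| ^ k / B_n ^ (k / 2)`. -/
def normMoment {Ω : Type*} [MeasurableSpace Ω] (P : Measure Ω) (X : ℕ → Ω → ℝ) (k : ℝ) (n : ℕ) :
    ℝ :=
  (∫ ω, |∑ i ∈ Finset.range n, X i ω| ^ k ∂P) / sumVar P X n ^ (k / 2)

end EntropicCLT

end

/-!
The sum `X_1 + ⋯ + X_n` is compared with a Gaussian law in total variation, with the rate `1 / √n`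
and a constant depending only on `J` and `M`; the relative entropy is then bounded by the total
variation distance.

*Total variation.* Let `f i` be the characteristic function of `X i` and `g i` that of the centered
Gaussian law of the same variance. Integration by parts gives `|f i t| ≤ 6 √J / |t|`, and the
doubling inequality `1 - |f (2 t)| ≤ 4 (1 - |f t|)` turns this decay into a quadratic gap near the
origin. Hence `|f i t| ≤ (1 + κ t ^ 2) ^ (-1 / 2)` for all `t`, with `κ` depending on `J` only
(`sq_norm_charFun_mul_le_one`), and the variances are at least `κ`, so that `g i` obeys the same
bound. By the third moments, `f i - g i` and its first two derivatives are `O (|t| ^ 3)`,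
`O (t ^ 2)` and `O (|t|)`. Telescoping the products (`norm_prod_sub_prod_bounds`) and using
Bernoulli's inequality for the powers of the envelope yields integrable bounds on `∏ f i - ∏ g i`
and on its second derivative, and Fourier inversion bounds the difference `u` of the densities:
`|u x| ≤ A / n` and `x ^ 2 * |u x| ≤ A`. Integrating the two bounds gives `∫ |u| = O (1 / √n)`
(`integral_abs_le_of_charLike`).

*Entropy.* Let `q` be the density of the sum and `φ` the Gaussian density of the same variance
`B`. Pointwise, the integrand of the relative entropy is at most `|q - φ|` plus the product of the
positive part of `q - φ` with `log (q / φ)` (`mul_klFun_div_le`). Since `q ≤ √J`, this logarithm is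
at most `O (1 + log n)` plus `x ^ 2 / (2 B)`. The quadratic term is handled by
Hölder's inequality; as only the positive part of `q - φ` occurs, the moment of order `k` of the sum
suffices, and no Gaussian moment enters (`klDiv_gaussianReal_le`).

*Constants.* The Lyapunov ratio of order three is comparable to `1 / √n`, so the factor `log n`
costs an arbitrarily small power of it, and the logarithm of a constant `A` is at most
`A ^ a / a`, which lets the factor `C (J, M)` absorb it (`entropy_bound_le`).
-/

namespace EntropicCLT

open Filter Topology Complex
open scoped Real

/-! ### Absolutely continuous densities -/

lemma continuous_of_absolutelyContinuous {p : ℝ → ℝ}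
    (hac : ∀ a b : ℝ, AbsolutelyContinuousOnInterval p a b) : Continuous p := by
  rw [continuous_iff_continuousAt]
  intro x
  refine (hac (x - 1) (x + 1)).continuousOn.continuousAt ?_
  rw [Set.uIcc_of_le (by linarith)]
  exact Icc_mem_nhds (by linarith) (by linarith)

/-- An integrable absolutely continuous function is bounded by its total variation: it comes
arbitrarily close to a non-positive value, since it is integrable. -/
lemma le_integral_abs_deriv {p : ℝ → ℝ}
    (hac : ∀ a b : ℝ, AbsolutelyContinuousOnInterval p a b) (hp : Integrable p)
    (hd : Integrable (deriv p)) (x : ℝ) : p x ≤ ∫ y, |deriv p y| := by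
  by_contra! hx
  set δ := p x - ∫ y, |deriv p y| with hδ
  have hδ0 : 0 < δ := by linarith
  have key : ∀ y, δ ≤ p y := by
    intro y
    have h1 := (hac y x).integral_deriv_eq_sub
    have h2 : ‖∫ z in y..x, deriv p z‖ ≤ ∫ z, |deriv p z| := by
      refine (intervalIntegral.norm_integral_le_integral_norm_uIoc).trans ?_
      exact setIntegral_le_integral hd.norm (ae_of_all _ fun _ => norm_nonneg _)
    rw [h1] at h2
    have := (le_abs_self _).trans h2
    linarith
  have : Integrable (fun _ : ℝ => δ) := by
    refine hp.mono (by fun_prop) (ae_of_all _ fun y => ?_)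
    have := key y
    rw [Real.norm_eq_abs, Real.norm_eq_abs, abs_of_pos hδ0]
    exact this.trans (le_abs_self _)
  rw [integrable_const_iff] at this
  rcases this with h | h
  · linarith
  · exact absurd h.measure_univ_lt_top (by simp)

lemma absolutelyContinuous_comp_mul (a b t : ℝ) {g g' : ℝ → ℝ} (hg : ∀ x, HasDerivAt g (g' x) x)
    (hc : Continuous g') : AbsolutelyContinuousOnInterval (fun x => g (t * x)) a b := by
  refine ContDiffOn.absolutelyContinuousOnInterval (ContDiff.contDiffOn ?_)
  have h : ContDiff ℝ 1 g := by
    rw [contDiff_one_iff_deriv]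
    refine ⟨fun x => (hg x).differentiableAt, ?_⟩
    rwa [show deriv g = g' from funext fun x => (hg x).deriv]
  exact h.comp (contDiff_const.mul contDiff_id)

/-- Integration by parts against an oscillating function with bounded antiderivative `g`. -/
lemma abs_integral_mul_le_div {p : ℝ → ℝ} (h0 : ∀ x, 0 ≤ p x)
    (hac : ∀ a b : ℝ, AbsolutelyContinuousOnInterval p a b) (hp : Integrable p)
    (hd : Integrable (deriv p)) {g g' : ℝ → ℝ} (hg : ∀ x, HasDerivAt g (g' x) x)
    (hc : Continuous g') (hg1 : ∀ x, |g x| ≤ 1) (hg1' : ∀ x, |g' x| ≤ 1) {t : ℝ} (ht : t ≠ 0) :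
    |∫ x, p x * g' (t * x)| ≤ 3 * (∫ y, |deriv p y|) / |t| := by
  set b := ∫ y, |deriv p y|
  have hcg : Continuous g := continuous_iff_continuousAt.2 fun x => (hg x).continuousAt
  have hint : Integrable fun x => p x * g' (t * x) := by
    refine hp.mul_bdd (c := 1) (by fun_prop) (ae_of_all _ fun x => hg1' _)
  have hlim := intervalIntegral_tendsto_integral hint tendsto_neg_atTop_atBot
    (tendsto_id (α := ℝ))
  refine le_of_tendsto hlim.abs (Eventually.of_forall fun R => ?_)
  have hder : ∀ x, deriv (fun x => g (t * x)) x = g' (t * x) * t := by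
    intro x
    have := (hg (t * x)).comp x ((hasDerivAt_id x).const_mul t)
    have h' := this.deriv
    simp only [mul_one] at h'
    exact h'
  have hparts := (hac (-R) R).integral_mul_deriv_eq_deriv_mul
    (absolutelyContinuous_comp_mul (-R) R t hg hc)
  simp_rw [hder, ← mul_assoc] at hparts
  rw [intervalIntegral.integral_mul_const] at hparts
  have hb : ∀ x, |p x * g (t * x)| ≤ b := fun x => by
    rw [abs_mul, abs_of_nonneg (h0 x)]
    exact (mul_le_of_le_one_right (h0 x) (hg1 _)).trans (le_integral_abs_deriv hac hp hd x)
  have h2 : |∫ z in (-R)..R, deriv p z * g (t * z)| ≤ b := by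
    rw [← Real.norm_eq_abs]
    refine (intervalIntegral.norm_integral_le_integral_norm_uIoc).trans ?_
    have hi : Integrable fun z => deriv p z * g (t * z) :=
      hd.mul_bdd (c := 1) (by fun_prop) (ae_of_all _ fun x => hg1 _)
    refine (setIntegral_le_integral hi.norm (ae_of_all _ fun _ => norm_nonneg _)).trans ?_
    refine integral_mono hi.norm hd.abs fun z => ?_
    simp only [norm_mul, Real.norm_eq_abs]
    exact mul_le_of_le_one_right (abs_nonneg _) (hg1 _)
  have h3 : |(∫ x in (-R)..R, p x * g' (t * x)) * t| ≤ 3 * b := by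
    rw [hparts]
    have e1 := abs_le.1 (hb R)
    have e2 := abs_le.1 (hb (-R))
    have e3 := abs_le.1 h2
    rw [abs_le]
    constructor <;> linarith [e1.1, e1.2, e2.1, e2.2, e3.1, e3.2]
  rw [abs_mul] at h3
  rw [le_div_iff₀ (abs_pos.2 ht)]
  exact h3

lemma IsACDensity.integrable {Ω : Type*} [MeasurableSpace Ω] {P : Measure Ω}
    [IsProbabilityMeasure P] {X : Ω → ℝ} (hX : Measurable X) {p : ℝ → ℝ}
    (h : IsACDensity P X p) : Integrable p := by
  have hc := continuous_of_absolutelyContinuous h.absolutelyContinuous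
  refine ⟨by fun_prop, ?_⟩
  rw [hasFiniteIntegral_iff_ofReal (ae_of_all _ h.nonneg)]
  have h1 : (P.map X) Set.univ = 1 := by
    have := Measure.isProbabilityMeasure_map (μ := P) hX.aemeasurable
    exact measure_univ
  rw [h.map_eq, withDensity_apply _ MeasurableSet.univ, Measure.restrict_univ] at h1
  rw [h1]
  simp

/-- Integration against a measure with density `p`. -/
lemma integral_withDensity_ofReal {E : Type*} [NormedAddCommGroup E] [NormedSpace ℝ E]
    {p : ℝ → ℝ} (hp : Measurable p) (h0 : ∀ x, 0 ≤ p x) (g : ℝ → E) :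
    ∫ x, g x ∂(volume.withDensity fun x => ENNReal.ofReal (p x)) = ∫ x, p x • g x := by
  rw [integral_withDensity_eq_integral_toReal_smul (by fun_prop) (by simp)]
  simp [h0]

lemma norm_charFun_le_div {μ : Measure ℝ} {p : ℝ → ℝ} (h0 : ∀ x, 0 ≤ p x)
    (hac : ∀ a b : ℝ, AbsolutelyContinuousOnInterval p a b) (hp : Integrable p)
    (hd : Integrable (deriv p)) (hμ : μ = volume.withDensity fun x => ENNReal.ofReal (p x))
    {t : ℝ} (ht : t ≠ 0) :
    ‖charFun μ t‖ ≤ 6 * (∫ y, |deriv p y|) / |t| := by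
  have hc := continuous_of_absolutelyContinuous hac
  have h1 : charFun μ t = ∫ x, (p x : ℂ) * cexp (t * x * I) := by
    rw [charFun_apply_real, hμ, integral_withDensity_ofReal hc.measurable h0]
    simp
  have hi : Integrable fun x => (p x : ℂ) * cexp (t * x * I) := by
    refine hp.ofReal.mul_bdd (c := 1) (by fun_prop) (ae_of_all _ fun x => ?_)
    rw [← ofReal_mul, norm_exp_ofReal_mul_I]
  have hre : (charFun μ t).re = ∫ x, p x * Real.cos (t * x) := by
    rw [h1]
    have := integral_re hi
    simp only [RCLike.re_to_complex] at this
    rw [← this]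
    refine integral_congr_ae (ae_of_all _ fun x => ?_)
    simp only [re_ofReal_mul, ← ofReal_mul t, exp_ofReal_mul_I_re]
  have him : (charFun μ t).im = ∫ x, p x * Real.sin (t * x) := by
    rw [h1]
    have := integral_im hi
    simp only [RCLike.im_to_complex] at this
    rw [← this]
    refine integral_congr_ae (ae_of_all _ fun x => ?_)
    simp only [im_ofReal_mul, ← ofReal_mul t, exp_ofReal_mul_I_im]
  have a1 := abs_integral_mul_le_div h0 hac hp hd (g := Real.sin) (g' := Real.cos)
    Real.hasDerivAt_sin Real.continuous_cos Real.abs_sin_le_one Real.abs_cos_le_one ht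
  have a2 := abs_integral_mul_le_div h0 hac hp hd (g := fun x => - Real.cos x) (g' := Real.sin)
    (fun x => by have := (Real.hasDerivAt_cos x).neg; rwa [neg_neg] at this) Real.continuous_sin
    (fun x => by simpa using Real.abs_cos_le_one x) Real.abs_sin_le_one ht
  calc ‖charFun μ t‖ ≤ |(charFun μ t).re| + |(charFun μ t).im| := norm_le_abs_re_add_abs_im _
    _ ≤ _ := by
      rw [hre, him]
      refine (add_le_add a1 a2).trans_eq ?_
      ring

/-! ### Decay of characteristic functions -/

lemma exists_phase (z : ℂ) : ∃ c : ℂ, ‖c‖ = 1 ∧ c * z = ‖z‖ := by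
  refine ⟨cexp ((-arg z : ℝ) * I), norm_exp_ofReal_mul_I _, ?_⟩
  conv_lhs => rw [← norm_mul_exp_arg_mul_I z]
  rw [mul_left_comm, ← Complex.exp_add]
  simp

/-- The doubling inequality, from `1 - cos (2 y) ≤ 4 (1 - cos y)` applied to the characteristic
function rotated by the phase which makes `charFun μ t` a non-negative real number. -/
lemma one_sub_norm_charFun_two_mul_le (μ : Measure ℝ) [IsProbabilityMeasure μ] (t : ℝ) :
    1 - ‖charFun μ (2 * t)‖ ≤ 4 * (1 - ‖charFun μ t‖) := by
  obtain ⟨c, hc, hct⟩ := exists_phase (charFun μ t)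
  set e : ℝ → ℂ := fun x => c * cexp (t * x * I) with he
  have he1 : ∀ x, ‖e x‖ = 1 := fun x => by
    rw [he]; simp only [norm_mul, hc, one_mul]
    rw [← ofReal_mul, norm_exp_ofReal_mul_I]
  have hie : Integrable e μ :=
    (integrable_const (1 : ℝ)).mono' (by fun_prop) (ae_of_all _ fun x => (he1 x).le)
  have hie2 : Integrable (fun x => e x ^ 2) μ :=
    (integrable_const (1 : ℝ)).mono' (by fun_prop) (ae_of_all _ fun x => by simp [he1 x])
  have h1 : ∫ x, e x ∂μ = ‖charFun μ t‖ := by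
    rw [← hct, charFun_apply_real, ← integral_const_mul]
  have h2 : ∫ x, e x ^ 2 ∂μ = c ^ 2 * charFun μ (2 * t) := by
    rw [charFun_apply_real, ← integral_const_mul]
    congr 1; ext x
    simp only [he, mul_pow, ← Complex.exp_nat_mul]
    congr 2; push_cast; ring
  have r1 : ∫ x, (e x).re ∂μ = ‖charFun μ t‖ := by
    have := integral_re hie
    simp only [RCLike.re_to_complex] at this
    rw [this, h1, ofReal_re]
  have r2 : ∫ x, (e x ^ 2).re ∂μ ≤ ‖charFun μ (2 * t)‖ := by
    have := integral_re hie2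
    simp only [RCLike.re_to_complex] at this
    rw [this, h2]
    refine (re_le_norm _).trans ?_
    simp [hc]
  have hpt : ∀ x, 1 - (e x ^ 2).re ≤ 4 * (1 - (e x).re) := by
    intro x
    have h := he1 x
    have hn : (e x).re ^ 2 + (e x).im ^ 2 = 1 := by
      have := Complex.sq_norm (e x)
      rw [h, normSq_apply] at this
      nlinarith
    have : (e x ^ 2).re = (e x).re ^ 2 - (e x).im ^ 2 := by
      rw [pow_two, mul_re]; ring
    rw [this]
    nlinarith [sq_nonneg ((e x).re - 1)]
  have hr1 : Integrable (fun x => (e x).re) μ := hie.re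
  have hr2 : Integrable (fun x => (e x ^ 2).re) μ := hie2.re
  have := integral_mono (μ := μ) ((integrable_const 1).sub hr2)
    (((integrable_const 1).sub hr1).const_mul 4) hpt
  simp only [Pi.sub_apply] at this
  rw [integral_sub (integrable_const 1) hr2, integral_const_mul,
    integral_sub (integrable_const 1) hr1] at this
  simp only [integral_const, probReal_univ, smul_eq_mul, mul_one] at this
  rw [r1] at this
  linarith

/-- Decay of order `1 / |t|` at infinity propagates to a quadratic gap `1 - |f t| ≥ c t ^ 2` near
the origin through the doubling inequality; the two bounds combine into a single envelope. -/
lemma sq_norm_charFun_mul_le_one {μ : Measure ℝ} [IsProbabilityMeasure μ] {K : ℝ} (hK : 0 < K)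
    (h : ∀ t ≠ 0, ‖charFun μ t‖ ≤ K / |t|) (t : ℝ) :
    ‖charFun μ t‖ ^ 2 * (1 + 1 / (32 * K ^ 2) * t ^ 2) ≤ 1 := by
  have hle : ‖charFun μ t‖ ≤ 1 := norm_charFun_le_one t
  have hn := norm_nonneg (charFun μ t)
  have hlarge : ∀ s : ℝ, 2 * K ≤ |s| → 1 / 2 ≤ 1 - ‖charFun μ s‖ := by
    intro s hs
    have hs0 : 0 < |s| := by linarith
    have h1 := h s (abs_pos.1 hs0)
    have : K / |s| ≤ 1 / 2 := by rw [div_le_iff₀ hs0]; linarith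
    linarith
  have hdouble : ∀ k : ℕ, ∀ s : ℝ, 2 * K ≤ 2 ^ k * |s| →
      (1 / 4) ^ k * (1 / 2) ≤ 1 - ‖charFun μ s‖ := by
    intro k
    induction k with
    | zero => intro s hs; simpa using hlarge s (by simpa using hs)
    | succ k ih =>
      intro s hs
      have h1 := ih (2 * s) (by rw [abs_mul, abs_two]; rw [pow_succ] at hs; linarith)
      have h2 := one_sub_norm_charFun_two_mul_le μ s
      rw [pow_succ]
      linarith
  rcases le_or_gt (2 * K) |t| with ht | ht
  · have ht0 : 0 < |t| := by linarith
    have h1 := h t (abs_pos.1 ht0)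
    rw [le_div_iff₀ ht0] at h1
    have h2 : ‖charFun μ t‖ ^ 2 * t ^ 2 ≤ K ^ 2 := by
      rw [← sq_abs t, ← mul_pow]; exact pow_le_pow_left₀ (by positivity) h1 2
    have h3 := hlarge t ht
    have h4 : ‖charFun μ t‖ ^ 2 ≤ 1 / 4 := by nlinarith
    have h5 : 1 / (32 * K ^ 2) * K ^ 2 = 1 / 32 := by field_simp
    have h6 : 0 < 1 / (32 * K ^ 2) := by positivity
    nlinarith [mul_le_mul_of_nonneg_left h2 h6.le]
  · rcases eq_or_ne t 0 with rfl | ht0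
    · simp
    have htp : 0 < |t| := abs_pos.2 ht0
    obtain ⟨k, hk1, hk2⟩ := exists_nat_pow_near (x := 2 * K / |t|) (y := 2)
      (by rw [le_div_iff₀ htp]; linarith) one_lt_two
    rw [le_div_iff₀ htp] at hk1
    rw [div_lt_iff₀ htp] at hk2
    have h1 := hdouble (k + 1) t hk2.le
    have h2 : t ^ 2 / (32 * K ^ 2) ≤ (1 / 4) ^ (k + 1) * (1 / 2) := by
      have h3 : (2 : ℝ) ^ k ≤ 2 * K / |t| := by rwa [le_div_iff₀ htp]
      have h4 : ((2 : ℝ) ^ k) ^ 2 * t ^ 2 ≤ 4 * K ^ 2 := by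
        rw [← sq_abs t, ← mul_pow]
        refine (pow_le_pow_left₀ (by positivity) hk1 2).trans_eq (by ring)
      have h5 : (1 / 4 : ℝ) ^ (k + 1) = 1 / (4 * ((2 : ℝ) ^ k) ^ 2) := by
        rw [pow_succ, one_div_pow, ← pow_mul, mul_comm k 2, pow_mul]; norm_num
      rw [h5, div_le_iff₀ (by positivity)]
      have h6 : 1 / (4 * ((2 : ℝ) ^ k) ^ 2) * (1 / 2) * (32 * K ^ 2)
        = 4 * K ^ 2 / ((2 : ℝ) ^ k) ^ 2 := by field_simp; ring
      rw [h6, le_div_iff₀ (by positivity)]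
      linarith
    set s := t ^ 2 / (32 * K ^ 2) with hs
    have hs0 : 0 ≤ s := by positivity
    have h3 : 1 / (32 * K ^ 2) * t ^ 2 = s := by rw [hs]; ring
    rw [h3]
    have h4 : ‖charFun μ t‖ ^ 2 ≤ 1 - s := by nlinarith
    nlinarith

lemma one_sub_norm_charFun_le {μ : Measure ℝ} [IsProbabilityMeasure μ]
    (h2 : Integrable (fun x => x ^ 2) μ) (t : ℝ) :
    1 - ‖charFun μ t‖ ≤ t ^ 2 * ∫ x, x ^ 2 ∂μ := by
  have hi : Integrable (fun x : ℝ => cexp (t * x * I)) μ :=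
    (integrable_const (1 : ℝ)).mono' (by fun_prop)
      (ae_of_all _ fun x => by rw [← ofReal_mul, norm_exp_ofReal_mul_I])
  have hre : (charFun μ t).re = ∫ x, Real.cos (t * x) ∂μ := by
    rw [charFun_apply_real]
    have := integral_re hi
    simp only [RCLike.re_to_complex] at this
    rw [← this]
    refine integral_congr_ae (ae_of_all _ fun x => ?_)
    simp only [← ofReal_mul, exp_ofReal_mul_I_re]
  have h3 : ∫ x, (1 - (t * x) ^ 2) ∂μ ≤ ∫ x, Real.cos (t * x) ∂μ := by
    refine integral_mono ?_ ?_ fun x => ?_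
    · simp_rw [mul_pow]
      exact (integrable_const 1).sub (h2.const_mul _)
    · exact (integrable_const (1 : ℝ)).mono' (by fun_prop)
        (ae_of_all _ fun x => Real.abs_cos_le_one _)
    · have := Real.one_sub_sq_div_two_le_cos (x := t * x)
      have h0 := sq_nonneg (t * x)
      simp only
      linarith
  simp_rw [mul_pow] at h3
  rw [integral_sub (integrable_const 1) (h2.const_mul _), integral_const_mul] at h3
  simp only [integral_const, probReal_univ, smul_eq_mul, mul_one] at h3
  have := re_le_norm (charFun μ t)
  linarith

/-- A law with characteristic function `O (1 / |t|)` cannot be concentrated. -/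
lemma one_div_le_integral_sq {μ : Measure ℝ} [IsProbabilityMeasure μ] {K : ℝ} (hK : 0 < K)
    (h : ∀ t ≠ 0, ‖charFun μ t‖ ≤ K / |t|) (h2 : Integrable (fun x => x ^ 2) μ) :
    1 / (32 * K ^ 2) ≤ ∫ x, x ^ 2 ∂μ := by
  have h1 := h (2 * K) (by positivity)
  rw [abs_of_pos (by positivity), show K / (2 * K) = 1 / 2 by field_simp] at h1
  have h3 := one_sub_norm_charFun_le h2 (2 * K)
  rw [div_le_iff₀ (by positivity)]
  nlinarith

end EntropicCLT

namespace EntropicCLT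

open Filter Topology Complex
open scoped Real

/-! ### Second-order control of characteristic functions -/

/-- A twice differentiable function which behaves like the characteristic function of a centered
law of variance `v`: it lies below the envelope `(1 + κ t ^ 2) ^ (-1 / 2)`, and its second
derivative is bounded by `C` and `C`-Lipschitz at the origin, where it equals `-v`. -/
structure CharLike (κ C v : ℝ) (f : ℝ → ℂ) : Prop where
  contDiff : ContDiff ℝ 2 f
  map_zero : f 0 = 1
  deriv_zero : deriv f 0 = 0
  envelope : ∀ t, ‖f t‖ ^ 2 * (1 + κ * t ^ 2) ≤ 1
  norm_deriv_deriv_le : ∀ t, ‖deriv (deriv f) t‖ ≤ C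
  norm_deriv_deriv_add_le : ∀ t, ‖deriv (deriv f) t + v‖ ≤ C * |t|

lemma contDiff_one_deriv {f : ℝ → ℂ} (hf : ContDiff ℝ 2 f) : ContDiff ℝ 1 (deriv f) := by
  have : ContDiff ℝ (1 + 1) f := by norm_num; exact hf
  exact (contDiff_succ_iff_deriv.1 this).2.2

lemma hasDerivAt_of_contDiff_two {f : ℝ → ℂ} (hf : ContDiff ℝ 2 f) (t : ℝ) :
    HasDerivAt f (deriv f t) t :=
  (hf.differentiable (by norm_num) t).hasDerivAt

lemma hasDerivAt_deriv_of_contDiff_two {f : ℝ → ℂ} (hf : ContDiff ℝ 2 f) (t : ℝ) :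
    HasDerivAt (deriv f) (deriv (deriv f) t) t :=
  ((contDiff_one_deriv hf).differentiable (by norm_num) t).hasDerivAt

/-- The mean value inequality from the origin. -/
lemma norm_sub_le_of_hasDerivAt {f f' : ℝ → ℂ} (hf : ∀ t, HasDerivAt f (f' t) t) {C t : ℝ}
    (h : ∀ s, |s| ≤ |t| → ‖f' s‖ ≤ C) : ‖f t - f 0‖ ≤ C * |t| := by
  have := (convex_Icc (-|t|) |t|).norm_image_sub_le_of_norm_hasDerivWithin_le
    (f := f) (f' := f') (x := 0) (y := t) (C := C)
    (fun s _ => (hf s).hasDerivWithinAt) (fun s hs => h s (abs_le.2 hs))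
    ⟨by simp, by simp⟩ ⟨neg_abs_le t, le_abs_self t⟩
  simpa using this

section

variable {κ C v : ℝ} {f : ℝ → ℂ}

lemma CharLike.const_nonneg (h : CharLike κ C v f) : 0 ≤ C :=
  (norm_nonneg _).trans (h.norm_deriv_deriv_le 0)

lemma CharLike.norm_deriv_le (h : CharLike κ C v f) (t : ℝ) : ‖deriv f t‖ ≤ C * |t| := by
  have := norm_sub_le_of_hasDerivAt (hasDerivAt_deriv_of_contDiff_two h.contDiff) (C := C) (t := t)
    fun s _ => h.norm_deriv_deriv_le s
  simpa [h.deriv_zero] using this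

lemma CharLike.norm_deriv_add_le (h : CharLike κ C v f) (t : ℝ) :
    ‖deriv f t + v * t‖ ≤ C * t ^ 2 := by
  have hd : ∀ s : ℝ, HasDerivAt (fun s : ℝ => deriv f s + v * s) (deriv (deriv f) s + v) s := by
    intro s
    have := (hasDerivAt_deriv_of_contDiff_two h.contDiff s).add
      ((hasDerivAt_id s).ofReal_comp.const_mul (v : ℂ))
    simp only [ofReal_one, mul_one, id] at this
    exact this
  have := norm_sub_le_of_hasDerivAt hd (C := C * |t|) (t := t) fun s hs =>
    (h.norm_deriv_deriv_add_le s).trans (mul_le_mul_of_nonneg_left hs h.const_nonneg)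
  simpa [h.deriv_zero, mul_assoc, ← pow_two] using this

lemma CharLike.norm_sub_le (h : CharLike κ C v f) (t : ℝ) :
    ‖f t - (1 - v * t ^ 2 / 2)‖ ≤ C * |t| ^ 3 := by
  have hd : ∀ s : ℝ, HasDerivAt (fun s : ℝ => f s + v * (s : ℂ) ^ 2 / 2)
      (deriv f s + v * s) s := by
    intro s
    have h2 : HasDerivAt (fun s : ℝ => (s : ℂ) ^ 2) (2 * s) s := by
      have := (hasDerivAt_id s).ofReal_comp.pow 2
      simp only [id, ofReal_one, mul_one, Nat.cast_ofNat, Nat.add_one_sub_one, pow_one] at this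
      exact this
    have := (hasDerivAt_of_contDiff_two h.contDiff s).add ((h2.const_mul (v : ℂ)).div_const 2)
    exact this.congr_deriv (by ring)
  have := norm_sub_le_of_hasDerivAt hd (C := C * t ^ 2) (t := t) fun s hs =>
    (h.norm_deriv_add_le s).trans (mul_le_mul_of_nonneg_left (sq_le_sq.2 hs) h.const_nonneg)
  simp only [h.map_zero, ofReal_zero] at this
  calc _ = ‖f t + v * (t : ℂ) ^ 2 / 2 - (1 + v * 0 ^ 2 / 2)‖ := by congr 1; ring
    _ ≤ C * t ^ 2 * |t| := this
    _ = C * |t| ^ 3 := by rw [← sq_abs]; ring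

variable {g : ℝ → ℂ}

lemma CharLike.norm_sub_le_two (hf : CharLike κ C v f) (hg : CharLike κ C v g) (t : ℝ) :
    ‖f t - g t‖ ≤ 2 * C * |t| ^ 3 := by
  have h1 := hf.norm_sub_le t
  have h2 := hg.norm_sub_le t
  calc _ = ‖(f t - (1 - v * t ^ 2 / 2)) - (g t - (1 - v * t ^ 2 / 2))‖ := by congr 1; ring
    _ ≤ _ := (_root_.norm_sub_le _ _).trans (by linarith)

lemma CharLike.norm_deriv_sub_le_two (hf : CharLike κ C v f) (hg : CharLike κ C v g) (t : ℝ) :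
    ‖deriv f t - deriv g t‖ ≤ 2 * C * t ^ 2 := by
  have h1 := hf.norm_deriv_add_le t
  have h2 := hg.norm_deriv_add_le t
  calc _ = ‖(deriv f t + v * t) - (deriv g t + v * t)‖ := by congr 1; ring
    _ ≤ _ := (_root_.norm_sub_le _ _).trans (by linarith)

lemma CharLike.norm_deriv_deriv_sub_le_two (hf : CharLike κ C v f) (hg : CharLike κ C v g)
    (t : ℝ) : ‖deriv (deriv f) t - deriv (deriv g) t‖ ≤ 2 * C * |t| := by
  have h1 := hf.norm_deriv_deriv_add_le t
  have h2 := hg.norm_deriv_deriv_add_le t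
  calc _ = ‖(deriv (deriv f) t + v) - (deriv (deriv g) t + v)‖ := by congr 1; ring
    _ ≤ _ := (_root_.norm_sub_le _ _).trans (by linarith)

end

lemma memLp_id_two {μ : Measure ℝ} [IsFiniteMeasure μ] (h3 : Integrable (fun x => |x| ^ 3) μ) :
    MemLp id 2 μ := by
  rw [memLp_two_iff_integrable_sq (by fun_prop)]
  refine ((integrable_const (1 : ℝ)).add h3).mono' (by fun_prop) (ae_of_all _ fun x => ?_)
  simp only [id, norm_pow, Real.norm_eq_abs, Pi.add_apply]
  have := abs_nonneg x
  rcases le_total |x| 1 with h | h <;> nlinarith [pow_nonneg this 3, pow_nonneg this 2]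

lemma deriv_deriv_charFun {μ : Measure ℝ} [IsFiniteMeasure μ] (h2 : MemLp id 2 μ) (t : ℝ) :
    deriv (deriv (charFun μ)) t = - ∫ x : ℝ, (x : ℂ) ^ 2 * cexp (t * x * I) ∂μ := by
  have := iteratedDeriv_charFun (n := 2) (t := t) (μ := μ) (by exact_mod_cast h2)
  rw [iteratedDeriv_succ, iteratedDeriv_one, I_sq, neg_one_mul] at this
  exact this

lemma charLike_charFun {μ : Measure ℝ} [IsProbabilityMeasure μ] {κ C v : ℝ}
    (h3 : Integrable (fun x => |x| ^ 3) μ) (hm : ∫ x, x ∂μ = 0) (hv : ∫ x, x ^ 2 ∂μ = v)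
    (hC : ∫ x, |x| ^ 3 ∂μ ≤ C) (hvC : v ≤ C)
    (henv : ∀ t, ‖charFun μ t‖ ^ 2 * (1 + κ * t ^ 2) ≤ 1) : CharLike κ C v (charFun μ) := by
  have h2 := memLp_id_two h3
  have h2' : MemLp id ((2 : ℕ) : ENNReal) μ := by exact_mod_cast h2
  have h1' : MemLp id ((1 : ℕ) : ENNReal) μ := h2.mono_exponent (by norm_num)
  have hsq : Integrable (fun x : ℝ => x ^ 2) μ := h2.integrable_sq
  have hsqe : ∀ t : ℝ, Integrable (fun x : ℝ => (x : ℂ) ^ 2 * cexp (t * x * I)) μ := fun t =>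
    hsq.mono' (by fun_prop) (ae_of_all _ fun x => by
      rw [norm_mul, ← ofReal_mul, norm_exp_ofReal_mul_I]; simp)
  refine ⟨by exact_mod_cast contDiff_charFun h2', by simp, ?_, henv, fun t => ?_, fun t => ?_⟩
  · have := iteratedDeriv_charFun (t := 0) h1'
    rw [iteratedDeriv_one] at this
    rw [this]
    simp only [pow_one, ofReal_zero, zero_mul, Complex.exp_zero, mul_one]
    rw [integral_complex_ofReal, hm, ofReal_zero, mul_zero]
  · rw [deriv_deriv_charFun h2, norm_neg]
    refine (norm_integral_le_integral_norm _).trans ?_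
    refine (integral_mono (hsqe t).norm hsq fun x => ?_).trans (hv.le.trans hvC)
    simp only [norm_mul, ← ofReal_mul, norm_exp_ofReal_mul_I]
    simp
  · have hvc : (v : ℂ) = ∫ x : ℝ, (x : ℂ) ^ 2 ∂μ := by
      rw [← hv, ← integral_complex_ofReal]; simp
    have hsqc : Integrable (fun x : ℝ => (x : ℂ) ^ 2) μ := by exact_mod_cast hsq.ofReal (𝕜 := ℂ)
    rw [deriv_deriv_charFun h2, hvc, neg_add_eq_sub, ← integral_sub hsqc (hsqe t)]
    refine (norm_integral_le_integral_norm _).trans ?_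
    calc _ ≤ ∫ x, |t| * |x| ^ 3 ∂μ := by
          refine integral_mono (hsqc.sub (hsqe t)).norm (h3.const_mul _) fun x => ?_
          have h := Real.norm_exp_I_mul_ofReal_sub_one_le (x := t * x)
          have e : (x : ℂ) ^ 2 - x ^ 2 * cexp (t * x * I)
            = - (x ^ 2 * (cexp (I * ((t * x : ℝ) : ℂ)) - 1)) := by
            push_cast; ring_nf
          simp only [e, norm_neg, norm_mul, norm_pow, norm_real, Real.norm_eq_abs] at h ⊢
          calc |x| ^ 2 * _ ≤ |x| ^ 2 * (|t| * |x|) := by gcongr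
            _ = _ := by ring
      _ = |t| * ∫ x, |x| ^ 3 ∂μ := integral_const_mul _ _
      _ ≤ C * |t| := by rw [mul_comm]; gcongr

/-! ### Products of characteristic functions -/

lemma deriv_deriv_mul {f g : ℝ → ℂ} (hf : ContDiff ℝ 2 f) (hg : ContDiff ℝ 2 g) (t : ℝ) :
    deriv (deriv fun s => f s * g s) t =
      deriv (deriv f) t * g t + 2 * (deriv f t * deriv g t) + f t * deriv (deriv g) t := by
  have h1 : (deriv fun s => f s * g s) = fun s => deriv f s * g s + f s * deriv g s :=
    funext fun s => ((hasDerivAt_of_contDiff_two hf s).mul (hasDerivAt_of_contDiff_two hg s)).deriv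
  rw [h1]
  refine (((hasDerivAt_deriv_of_contDiff_two hf t).mul (hasDerivAt_of_contDiff_two hg t)).add
    ((hasDerivAt_of_contDiff_two hf t).mul
      (hasDerivAt_deriv_of_contDiff_two hg t))).deriv.trans ?_
  ring

lemma deriv_mul_of_contDiff_two {f g : ℝ → ℂ} (hf : ContDiff ℝ 2 f) (hg : ContDiff ℝ 2 g)
    (t : ℝ) : (deriv fun s => f s * g s) t = deriv f t * g t + f t * deriv g t :=
  ((hasDerivAt_of_contDiff_two hf t).mul (hasDerivAt_of_contDiff_two hg t)).deriv

lemma norm_mul_le_mul {a b : ℂ} {x y : ℝ} (ha : ‖a‖ ≤ x) (hb : ‖b‖ ≤ y) : ‖a * b‖ ≤ x * y := by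
  rw [norm_mul]
  exact mul_le_mul ha hb (norm_nonneg _) ((norm_nonneg _).trans ha)

/-- Bounds at a point for a product of `CharLike` functions. The numbers `e * w` and `D * w` bound
the first and second derivatives of each factor, and `w` the factors themselves. -/
lemma norm_prod_bounds {ι : Type*} {f : ι → ℝ → ℂ} {t w e D : ℝ} (hw : 0 ≤ w)
    (s : Finset ι) (hc : ∀ i, ContDiff ℝ 2 (f i)) (h0 : ∀ i ∈ s, ‖f i t‖ ≤ w)
    (h1 : ∀ i ∈ s, ‖deriv (f i) t‖ ≤ e * w) (h2 : ∀ i ∈ s, ‖deriv (deriv (f i)) t‖ ≤ D * w) :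
    ‖∏ i ∈ s, f i t‖ ≤ w ^ s.card ∧
    ‖deriv (fun u => ∏ i ∈ s, f i u) t‖ ≤ s.card * e * w ^ s.card ∧
    ‖deriv (deriv fun u => ∏ i ∈ s, f i u) t‖ ≤ (s.card * D + s.card ^ 2 * e ^ 2) * w ^ s.card := by
  classical
  induction s using Finset.induction_on with
  | empty => simp
  | insert j s hj ih =>
    have hcs : ContDiff ℝ 2 (fun u => ∏ i ∈ s, f i u) := contDiff_prod fun i _ => hc i
    obtain ⟨i0, i1, i2⟩ := ih (fun i hi => h0 i (Finset.mem_insert_of_mem hi))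
      (fun i hi => h1 i (Finset.mem_insert_of_mem hi))
      (fun i hi => h2 i (Finset.mem_insert_of_mem hi))
    have j0 := h0 j (Finset.mem_insert_self _ _)
    have j1 := h1 j (Finset.mem_insert_self _ _)
    have j2 := h2 j (Finset.mem_insert_self _ _)
    simp_rw [Finset.prod_insert hj, Finset.card_insert_of_notMem hj]
    rw [deriv_deriv_mul (hc j) hcs, deriv_mul_of_contDiff_two (hc j) hcs]
    set m : ℝ := (s.card : ℝ) with hm
    have hm0 : 0 ≤ m := by positivity
    push_cast
    rw [← hm]
    refine ⟨?_, ?_, ?_⟩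
    · exact (norm_mul_le_mul j0 i0).trans_eq (by ring)
    · refine (norm_add_le _ _).trans ?_
      refine (add_le_add (norm_mul_le_mul j1 i0) (norm_mul_le_mul j0 i1)).trans_eq ?_
      ring
    · refine (norm_add₃_le).trans ?_
      refine (add_le_add (add_le_add (norm_mul_le_mul j2 i0) (norm_mul_le_mul (x := 2) (by simp)
        (norm_mul_le_mul j1 i1))) (norm_mul_le_mul j0 i2)).trans ?_
      have : 0 ≤ e ^ 2 * w ^ (s.card + 1) := by positivity
      rw [pow_succ w] at this ⊢
      linarith

/-- The telescoping comparison of two products of `CharLike` functions, with two derivatives. -/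
lemma norm_prod_sub_prod_bounds {ι : Type*} {f g : ι → ℝ → ℂ} {t w e D v0 v1 v2 : ℝ}
    (hw : 0 ≤ w) (he : 0 ≤ e) (hD : 0 ≤ D) (hv0 : 0 ≤ v0) (hv1 : 0 ≤ v1) (s : Finset ι)
    (hcf : ∀ i, ContDiff ℝ 2 (f i)) (hcg : ∀ i, ContDiff ℝ 2 (g i))
    (hf0 : ∀ i ∈ s, ‖f i t‖ ≤ w) (hf1 : ∀ i ∈ s, ‖deriv (f i) t‖ ≤ e * w)
    (hf2 : ∀ i ∈ s, ‖deriv (deriv (f i)) t‖ ≤ D * w)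
    (hg0 : ∀ i ∈ s, ‖g i t‖ ≤ w) (hg1 : ∀ i ∈ s, ‖deriv (g i) t‖ ≤ e * w)
    (hg2 : ∀ i ∈ s, ‖deriv (deriv (g i)) t‖ ≤ D * w)
    (h0 : ∀ i ∈ s, ‖f i t - g i t‖ ≤ v0 * w)
    (h1 : ∀ i ∈ s, ‖deriv (f i) t - deriv (g i) t‖ ≤ v1 * w)
    (h2 : ∀ i ∈ s, ‖deriv (deriv (f i)) t - deriv (deriv (g i)) t‖ ≤ v2 * w) :
    ‖∏ i ∈ s, f i t - ∏ i ∈ s, g i t‖ ≤ s.card * v0 * w ^ s.card ∧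
    ‖deriv (fun u => ∏ i ∈ s, f i u) t - deriv (fun u => ∏ i ∈ s, g i u) t‖ ≤
      (s.card * v1 + s.card ^ 2 * v0 * e) * w ^ s.card ∧
    ‖deriv (deriv fun u => ∏ i ∈ s, f i u) t - deriv (deriv fun u => ∏ i ∈ s, g i u) t‖ ≤
      (s.card * v2 + 2 * s.card ^ 2 * v1 * e + s.card ^ 2 * v0 * D + s.card ^ 3 * v0 * e ^ 2) *
        w ^ s.card := by
  classical
  induction s using Finset.induction_on with
  | empty => simp
  | insert j s hj ih =>
    have hs : ∀ {q : ι → Prop}, (∀ i ∈ insert j s, q i) → ∀ i ∈ s, q i :=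
      fun h i hi => h i (Finset.mem_insert_of_mem hi)
    have hcs : ContDiff ℝ 2 (fun u => ∏ i ∈ s, f i u) := contDiff_prod fun i _ => hcf i
    have hct : ContDiff ℝ 2 (fun u => ∏ i ∈ s, g i u) := contDiff_prod fun i _ => hcg i
    obtain ⟨i0, i1, i2⟩ := ih (hs hf0) (hs hf1) (hs hf2) (hs hg0) (hs hg1) (hs hg2) (hs h0)
      (hs h1) (hs h2)
    obtain ⟨k0, k1, k2⟩ := norm_prod_bounds hw s hcf (hs hf0) (hs hf1) (hs hf2)
    have hjm := Finset.mem_insert_self j s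
    have g0 := hg0 j hjm
    have g1 := hg1 j hjm
    have g2 := hg2 j hjm
    have l0 := h0 j hjm
    have l1 := h1 j hjm
    have l2 := h2 j hjm
    simp_rw [Finset.prod_insert hj, Finset.card_insert_of_notMem hj]
    rw [deriv_deriv_mul (hcf j) hcs, deriv_mul_of_contDiff_two (hcf j) hcs,
      deriv_deriv_mul (hcg j) hct, deriv_mul_of_contDiff_two (hcg j) hct]
    set m : ℝ := (s.card : ℝ) with hm
    have hm0 : 0 ≤ m := by positivity
    push_cast
    rw [← hm]
    set F := ∏ i ∈ s, f i t
    set F1 := deriv (fun u => ∏ i ∈ s, f i u) t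
    set F2 := deriv (deriv fun u => ∏ i ∈ s, f i u) t
    set G := ∏ i ∈ s, g i t
    set G1 := deriv (fun u => ∏ i ∈ s, g i u) t
    set G2 := deriv (deriv fun u => ∏ i ∈ s, g i u) t
    refine ⟨?_, ?_, ?_⟩
    · have e1 : f j t * F - g j t * G = (f j t - g j t) * F + g j t * (F - G) := by ring
      rw [e1]
      refine (norm_add_le _ _).trans ?_
      refine (add_le_add (norm_mul_le_mul l0 k0) (norm_mul_le_mul g0 i0)).trans_eq ?_
      ring
    · have e1 : deriv (f j) t * F + f j t * F1 - (deriv (g j) t * G + g j t * G1)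
        = (deriv (f j) t - deriv (g j) t) * F + (f j t - g j t) * F1
          + (deriv (g j) t * (F - G) + g j t * (F1 - G1)) := by ring
      rw [e1]
      refine (norm_add_le _ _).trans ?_
      refine (add_le_add ((norm_add_le _ _).trans (add_le_add (norm_mul_le_mul l1 k0)
        (norm_mul_le_mul l0 k1))) ((norm_add_le _ _).trans
        (add_le_add (norm_mul_le_mul g1 i0) (norm_mul_le_mul g0 i1)))).trans ?_
      have : 0 ≤ v0 * e * (w ^ s.card * w) := by positivity
      rw [pow_succ w]
      linarith
    · have e1 : deriv (deriv (f j)) t * F + 2 * (deriv (f j) t * F1) + f j t * F2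
          - (deriv (deriv (g j)) t * G + 2 * (deriv (g j) t * G1) + g j t * G2)
        = ((deriv (deriv (f j)) t - deriv (deriv (g j)) t) * F
            + 2 * ((deriv (f j) t - deriv (g j) t) * F1) + (f j t - g j t) * F2)
          + (deriv (deriv (g j)) t * (F - G) + 2 * (deriv (g j) t * (F1 - G1))
            + g j t * (F2 - G2)) := by ring
      rw [e1]
      refine (norm_add_le _ _).trans ?_
      refine (add_le_add (norm_add₃_le.trans (add_le_add (add_le_add (norm_mul_le_mul l2 k0)
        (norm_mul_le_mul (x := 2) (by simp) (norm_mul_le_mul l1 k1))) (norm_mul_le_mul l0 k2)))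
        (norm_add₃_le.trans (add_le_add (add_le_add (norm_mul_le_mul g2 i0)
        (norm_mul_le_mul (x := 2) (by simp) (norm_mul_le_mul g1 i1)))
        (norm_mul_le_mul g0 i2)))).trans ?_
      have p1 : 0 ≤ v1 * e * (w ^ s.card * w) := by positivity
      have p2 : 0 ≤ v0 * D * (w ^ s.card * w) := by positivity
      have p3 : 0 ≤ v0 * e ^ 2 * (w ^ s.card * w) := by positivity
      have p4 : 0 ≤ m * (v0 * e ^ 2 * (w ^ s.card * w)) := by positivity
      rw [pow_succ w]
      linarith

end EntropicCLT

namespace EntropicCLT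

open Filter Topology Complex
open scoped Real FourierTransform

/-! ### Fourier inversion -/

lemma integrable_inv_one_add_mul_sq {l : ℝ} (hl : 0 < l) :
    Integrable fun t : ℝ => (1 + l * t ^ 2)⁻¹ := by
  have h := integrable_inv_one_add_sq.comp_mul_left' (R := √l) (by positivity)
  simpa [mul_pow, Real.sq_sqrt hl.le] using h

lemma integral_inv_one_add_mul_sq {l : ℝ} (hl : 0 < l) :
    ∫ t : ℝ, (1 + l * t ^ 2)⁻¹ = π / √l := by
  have h := Measure.integral_comp_mul_left (fun t : ℝ => (1 + t ^ 2)⁻¹) (√l)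
  simp only [mul_pow, Real.sq_sqrt hl.le, integral_univ_inv_one_add_sq, smul_eq_mul] at h
  rw [h, abs_of_pos (by positivity)]
  ring

/-- A pointwise bound from Fourier inversion. (The sharp constant `1 / (2 π)` is not kept.) -/
lemma norm_le_of_norm_fourier_le {f : ℝ → ℂ} (hc : Continuous f) (hf : Integrable f) {a l : ℝ}
    (ha : 0 ≤ a) (hl : 0 < l)
    (h : ∀ t : ℝ, ‖∫ x : ℝ, cexp (t * x * I) * f x‖ ≤ a * (1 + l * t ^ 2)⁻¹) (x : ℝ) :
    ‖f x‖ ≤ a * (π / √l) := by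
  have hb : ∀ w : ℝ, ‖𝓕 f w‖ ≤ a * (1 + l * w ^ 2)⁻¹ := by
    intro w
    have e : 𝓕 f w = ∫ x : ℝ, cexp ((-2 * π * w : ℝ) * x * I) * f x := by
      rw [Real.fourier_real_eq_integral_exp_smul]
      congr 1; ext v
      rw [smul_eq_mul]; congr 2; push_cast; ring
    rw [e]
    refine (h _).trans ?_
    have : w ^ 2 ≤ (-2 * π * w) ^ 2 := by
      have h1 := Real.pi_gt_three
      have h2 : (1 : ℝ) ≤ (2 * π) ^ 2 := by nlinarith
      nlinarith [sq_nonneg w]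
    gcongr
  have hcF : Continuous (𝓕 f) :=
    VectorFourier.fourierIntegral_continuous Real.continuous_fourierChar
      (L := innerₗ ℝ) (by exact continuous_inner) hf
  have hg := (integrable_inv_one_add_mul_sq hl).const_mul a
  have hiF : Integrable (𝓕 f) :=
    hg.mono' hcF.aestronglyMeasurable (ae_of_all _ hb)
  rw [← congrFun (hc.fourierInv_fourier_eq hf hiF) x, Real.fourierInv_eq']
  refine (norm_integral_le_integral_norm _).trans ?_
  calc _ = ∫ w, ‖𝓕 f w‖ := by
        congr 1; ext w
        rw [norm_smul, norm_exp_ofReal_mul_I, one_mul]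
    _ ≤ ∫ w, a * (1 + l * w ^ 2)⁻¹ := integral_mono hiF.norm hg hb
    _ = _ := by rw [integral_const_mul, integral_inv_one_add_mul_sq hl]

lemma integral_abs_le_of_abs_le {u : ℝ → ℝ} (hu : Integrable u) {A N : ℝ} (hN : 0 < N)
    (h0 : ∀ x, |u x| ≤ A / N) (h2 : ∀ x, x ^ 2 * |u x| ≤ A) :
    ∫ x, |u x| ≤ 2 * π * A / √N := by
  have hN' : 0 < N⁻¹ := inv_pos.2 hN
  have hpt : ∀ x, |u x| ≤ 2 * A / N * (1 + N⁻¹ * x ^ 2)⁻¹ := by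
    intro x
    rw [← div_eq_mul_inv, le_div_iff₀ (by positivity)]
    have h3 := mul_le_mul_of_nonneg_left (h2 x) hN'.le
    have h1 := h0 x
    rw [div_eq_mul_inv] at h1 ⊢
    linarith
  calc _ ≤ ∫ x, 2 * A / N * (1 + N⁻¹ * x ^ 2)⁻¹ :=
        integral_mono hu.abs ((integrable_inv_one_add_mul_sq hN').const_mul _) hpt
    _ = 2 * A / N * (π * √N) := by
        rw [integral_const_mul, integral_inv_one_add_mul_sq hN', Real.sqrt_inv, div_inv_eq_mul]
    _ = _ := by
        have : N = √N * √N := (Real.mul_self_sqrt hN.le).symm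
        have hs : 0 < √N := Real.sqrt_pos.2 hN
        nth_rw 1 [this]
        field_simp

/-! ### Comparison of the characteristic functions of the sums -/

/-- Powers of the envelope, by Bernoulli's inequality. -/
lemma inv_sqrt_pow_le {κ t : ℝ} (hκ : 0 < κ) {n m : ℕ} (hn : 11 ≤ n) (hm : n ≤ m + 3) :
    (√(1 + κ * t ^ 2))⁻¹ ^ m ≤ ((1 + κ * n / 18 * t ^ 2) ^ 4)⁻¹ := by
  set s := √(1 + κ * t ^ 2) with hs
  have hx : 0 ≤ κ * t ^ 2 := by positivity
  have hs1 : 1 ≤ s := Real.one_le_sqrt.2 (by linarith)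
  have hs2 : s ^ 2 = 1 + κ * t ^ 2 := Real.sq_sqrt (by positivity)
  -- eight factors of the envelope for each unit of `l`, which makes the exponent `4` below
  obtain ⟨l, hl8, hl18⟩ : ∃ l : ℕ, 8 * l ≤ m ∧ n ≤ 18 * l := ⟨(n - 3) / 8, by omega, by omega⟩
  rw [inv_pow]
  refine inv_anti₀ (by positivity) ?_
  calc (1 + κ * n / 18 * t ^ 2) ^ 4 ≤ (1 + l * (κ * t ^ 2)) ^ 4 := by
        have : (n : ℝ) ≤ 18 * l := by exact_mod_cast hl18
        have := mul_le_mul_of_nonneg_right this hx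
        refine pow_le_pow_left₀ (by positivity) ?_ 4
        linarith
    _ ≤ ((1 + κ * t ^ 2) ^ l) ^ 4 :=
        pow_le_pow_left₀ (by positivity) (one_add_mul_le_pow (by linarith) l) 4
    _ = s ^ (8 * l) := by rw [← hs2, ← pow_mul, ← pow_mul]; congr 1; ring
    _ ≤ s ^ m := pow_le_pow_right₀ hs1 hl8

lemma abs_pow_le_mul {l t : ℝ} (hl : 0 < l) {k : ℕ} (hk : k ≤ 6) :
    |t| ^ k * ((1 + l * t ^ 2) ^ 4)⁻¹ ≤ (√l ^ k)⁻¹ * (1 + l * t ^ 2)⁻¹ := by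
  set y := √l * |t| with hy
  have hs : 0 < √l := Real.sqrt_pos.2 hl
  have hy0 : 0 ≤ y := by positivity
  have hy2 : l * t ^ 2 = y ^ 2 := by rw [hy, mul_pow, Real.sq_sqrt hl.le, sq_abs]
  rw [hy2]
  have h1 : y ^ k ≤ (1 + y ^ 2) ^ 3 := by
    rcases le_total y 1 with h | h
    · exact (pow_le_one₀ hy0 h).trans (one_le_pow₀ (by nlinarith))
    · calc y ^ k ≤ y ^ 6 := pow_le_pow_right₀ h hk
        _ = (y ^ 2) ^ 3 := by ring
        _ ≤ _ := by gcongr; linarith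
  have h2 : |t| ^ k = (√l ^ k)⁻¹ * y ^ k := by
    rw [hy, mul_pow]; field_simp
  rw [h2, mul_assoc]
  gcongr
  rw [← div_eq_mul_inv, div_le_iff₀ (by positivity)]
  calc y ^ k ≤ _ := h1
    _ = _ := by field_simp

/-- Quantitative comparison, uniformly in the number `n ≥ 11` of factors: the difference of the
products is `O (1 / √n)`, and that of their second derivatives is `O (√n)`, times a
function integrating to `O (1 / √n)`. -/
lemma CharLike.norm_prod_sub_prod_le {κ C : ℝ} (hκ : 0 < κ) {v : ℕ → ℝ} {f g : ℕ → ℝ → ℂ}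
    (hf : ∀ i, CharLike κ C (v i) (f i)) (hg : ∀ i, CharLike κ C (v i) (g i)) {n : ℕ}
    (hn : 11 ≤ n) (t : ℝ) :
    ‖∏ i ∈ Finset.range n, f i t - ∏ i ∈ Finset.range n, g i t‖ ≤
      2 * C * n * (√(κ * n / 18) ^ 3)⁻¹ * (1 + κ * n / 18 * t ^ 2)⁻¹ ∧
    ‖deriv (deriv fun u => ∏ i ∈ Finset.range n, f i u) t -
        deriv (deriv fun u => ∏ i ∈ Finset.range n, g i u) t‖ ≤
      (2 * C * n * (√(κ * n / 18) ^ 1)⁻¹ + 6 * C ^ 2 * n ^ 2 * (√(κ * n / 18) ^ 3)⁻¹ +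
        2 * C ^ 3 * n ^ 3 * (√(κ * n / 18) ^ 5)⁻¹) * (1 + κ * n / 18 * t ^ 2)⁻¹ := by
  have hC : 0 ≤ C := (hf 0).const_nonneg
  set W := √(1 + κ * t ^ 2) with hW
  have hx : 0 ≤ κ * t ^ 2 := by positivity
  have hW1 : 1 ≤ W := Real.one_le_sqrt.2 (by linarith)
  have hW0 : 0 < W := by linarith
  have hWw : W * W⁻¹ = 1 := mul_inv_cancel₀ hW0.ne'
  have hn0 : (0 : ℝ) < n := by exact_mod_cast (by omega : 0 < n)
  have henv : ∀ {x : ℂ}, ‖x‖ ^ 2 * (1 + κ * t ^ 2) ≤ 1 → ‖x‖ ≤ W⁻¹ := by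
    intro x h
    rw [← Real.sq_sqrt (show 0 ≤ 1 + κ * t ^ 2 by positivity), ← hW, ← mul_pow] at h
    have := (pow_le_one_iff_of_nonneg (by positivity) two_ne_zero).1 h
    rwa [← one_div, le_div_iff₀ hW0]
  have hmul : ∀ y : ℝ, y * W * W⁻¹ = y := fun y => by rw [mul_assoc, hWw, mul_one]
  obtain ⟨b0, -, b2⟩ := norm_prod_sub_prod_bounds (t := t) (w := W⁻¹) (e := C * |t| * W)
    (D := C * W) (v0 := 2 * C * |t| ^ 3 * W) (v1 := 2 * C * t ^ 2 * W) (v2 := 2 * C * |t| * W)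
    (by positivity) (by positivity) (by positivity) (by positivity) (by positivity)
    (Finset.range n) (fun i => (hf i).contDiff) (fun i => (hg i).contDiff)
    (fun i _ => henv ((hf i).envelope t))
    (fun i _ => by rw [hmul]; exact (hf i).norm_deriv_le t)
    (fun i _ => by rw [hmul]; exact (hf i).norm_deriv_deriv_le t)
    (fun i _ => henv ((hg i).envelope t))
    (fun i _ => by rw [hmul]; exact (hg i).norm_deriv_le t)
    (fun i _ => by rw [hmul]; exact (hg i).norm_deriv_deriv_le t)
    (fun i _ => by rw [hmul]; exact (hf i).norm_sub_le_two (hg i) t)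
    (fun i _ => by rw [hmul]; exact (hf i).norm_deriv_sub_le_two (hg i) t)
    (fun i _ => by rw [hmul]; exact (hf i).norm_deriv_deriv_sub_le_two (hg i) t)
  rw [Finset.card_range] at b0 b2
  set l := κ * n / 18 with hl
  have hl0 : 0 < l := by positivity
  set E := ((1 + l * t ^ 2) ^ 4)⁻¹ with hE
  have hWE : ∀ j ≤ 3, W ^ j * W⁻¹ ^ n ≤ E := by
    intro j hj
    have : W ^ j * W⁻¹ ^ n = W⁻¹ ^ (n - j) := by
      rw [← Nat.sub_add_cancel (show j ≤ n by omega), pow_add, Nat.add_sub_cancel, mul_left_comm,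
        ← mul_pow, hWw, one_pow, mul_one]
    rw [this]
    exact inv_sqrt_pow_le hκ hn (by omega)
  have w1 := hWE 1 (by norm_num)
  have w2 := hWE 2 (by norm_num)
  have w3 := hWE 3 (by norm_num)
  have t1 := abs_pow_le_mul (t := t) hl0 (k := 1) (by norm_num)
  have t3 := abs_pow_le_mul (t := t) hl0 (k := 3) (by norm_num)
  have t5 := abs_pow_le_mul (t := t) hl0 (k := 5) (by norm_num)
  rw [← hE] at t1 t3 t5
  have ht2 : t ^ 2 = |t| ^ 2 := (sq_abs t).symm
  constructor
  · calc _ ≤ _ := b0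
      _ = 2 * C * n * (|t| ^ 3 * (W ^ 1 * W⁻¹ ^ n)) := by ring
      _ ≤ 2 * C * n * (|t| ^ 3 * E) := by gcongr
      _ ≤ 2 * C * n * ((√l ^ 3)⁻¹ * (1 + l * t ^ 2)⁻¹) := by gcongr
      _ = _ := by ring
  · calc _ ≤ _ := b2
      _ = 2 * C * n * (|t| ^ 1 * (W ^ 1 * W⁻¹ ^ n))
          + 6 * C ^ 2 * n ^ 2 * (|t| ^ 3 * (W ^ 2 * W⁻¹ ^ n))
          + 2 * C ^ 3 * n ^ 3 * (|t| ^ 5 * (W ^ 3 * W⁻¹ ^ n)) := by rw [ht2]; ring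
      _ ≤ 2 * C * n * (|t| ^ 1 * E) + 6 * C ^ 2 * n ^ 2 * (|t| ^ 3 * E)
          + 2 * C ^ 3 * n ^ 3 * (|t| ^ 5 * E) := by gcongr
      _ ≤ 2 * C * n * ((√l ^ 1)⁻¹ * (1 + l * t ^ 2)⁻¹)
          + 6 * C ^ 2 * n ^ 2 * ((√l ^ 3)⁻¹ * (1 + l * t ^ 2)⁻¹)
          + 2 * C ^ 3 * n ^ 3 * ((√l ^ 5)⁻¹ * (1 + l * t ^ 2)⁻¹) := by gcongr
      _ = _ := by ring

/-- The constant of the `L¹` comparison. -/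
noncomputable def totalVariationConst (κ C : ℝ) : ℝ :=
  π * (2 * C * (18 / κ) ^ 2 + 2 * C * (18 / κ) + 6 * C ^ 2 * (18 / κ) ^ 2 +
    2 * C ^ 3 * (18 / κ) ^ 3)

/-- If the Fourier transform of `u` is the difference of two products of `CharLike` functions, and
that of `x ^ 2 * u` is minus its second derivative, then the `L¹` norm of `u` is `O (1 / √n)`. -/
lemma integral_abs_le_of_charLike {κ C : ℝ} (hκ : 0 < κ) {v : ℕ → ℝ} {f g : ℕ → ℝ → ℂ}
    (hf : ∀ i, CharLike κ C (v i) (f i)) (hg : ∀ i, CharLike κ C (v i) (g i)) {n : ℕ}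
    (hn : 11 ≤ n) {u : ℝ → ℝ} (hu : Continuous u) (hi : Integrable u)
    (hi2 : Integrable fun x => x ^ 2 * u x)
    (h0 : ∀ t : ℝ, ∫ x : ℝ, cexp (t * x * I) * u x =
      ∏ i ∈ Finset.range n, f i t - ∏ i ∈ Finset.range n, g i t)
    (h2 : ∀ t : ℝ, ∫ x : ℝ, cexp (t * x * I) * ((x ^ 2 * u x : ℝ) : ℂ) =
      -(deriv (deriv fun s => ∏ i ∈ Finset.range n, f i s) t -
        deriv (deriv fun s => ∏ i ∈ Finset.range n, g i s) t)) :
    ∫ x, |u x| ≤ 2 * π * totalVariationConst κ C / √n := by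
  have hC : 0 ≤ C := (hf 0).const_nonneg
  have hn0 : (0 : ℝ) < n := by exact_mod_cast (by omega : 0 < n)
  set l := κ * n / 18 with hl
  have hl0 : 0 < l := by positivity
  set s := √l with hs
  have hs0 : 0 < s := Real.sqrt_pos.2 hl0
  have hs2 : s ^ 2 = κ * n / 18 := Real.sq_sqrt hl0.le
  have hn18 : (n : ℝ) = 18 / κ * s ^ 2 := by rw [hs2]; field_simp
  have hb := CharLike.norm_prod_sub_prod_le hκ hf hg hn
  set R := 18 / κ with hR
  have hR0 : 0 < R := by positivity
  refine integral_abs_le_of_abs_le hi hn0 (fun x => ?_) (fun x => ?_)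
  · have h := norm_le_of_norm_fourier_le (f := fun x => (u x : ℂ)) (by fun_prop) hi.ofReal
      (a := 2 * C * n * (s ^ 3)⁻¹) (l := l) (by positivity) hl0
      (fun t => by rw [h0 t]; exact (hb t).1) x
    rw [norm_real, Real.norm_eq_abs] at h
    refine h.trans ?_
    have e : 2 * C * n * (s ^ 3)⁻¹ * (π / s) = π * (2 * C * R ^ 2) / n := by
      rw [hn18]; field_simp
    rw [← hs, e, totalVariationConst]
    gcongr
    have p1 : 0 ≤ 2 * C * R + 6 * C ^ 2 * R ^ 2 + 2 * C ^ 3 * R ^ 3 := by positivity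
    linarith
  · have h := norm_le_of_norm_fourier_le (f := fun x => ((x ^ 2 * u x : ℝ) : ℂ)) (by fun_prop)
      hi2.ofReal (a := 2 * C * n * (s ^ 1)⁻¹ + 6 * C ^ 2 * n ^ 2 * (s ^ 3)⁻¹ +
        2 * C ^ 3 * n ^ 3 * (s ^ 5)⁻¹) (l := l) (by positivity) hl0
      (fun t => by rw [h2 t, norm_neg]; exact (hb t).2) x
    rw [norm_real, Real.norm_eq_abs, abs_mul, abs_of_nonneg (sq_nonneg x)] at h
    refine h.trans ?_
    have e : (2 * C * n * (s ^ 1)⁻¹ + 6 * C ^ 2 * n ^ 2 * (s ^ 3)⁻¹ +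
        2 * C ^ 3 * n ^ 3 * (s ^ 5)⁻¹) * (π / s)
        = π * (2 * C * R + 6 * C ^ 2 * R ^ 2 + 2 * C ^ 3 * R ^ 3) := by
      rw [hn18]; field_simp
    rw [← hs, e, totalVariationConst]
    gcongr
    have p1 : 0 ≤ 2 * C * R ^ 2 := by positivity
    linarith

end EntropicCLT

namespace EntropicCLT

open Filter Topology Complex
open scoped Real NNReal

/-! ### The density of the sum -/

/-- The convolution of a probability measure with a bounded continuous density has a continuous
density with the same bound. -/
lemma exists_density_conv {ν : Measure ℝ} [IsProbabilityMeasure ν] {p : ℝ → ℝ} {b : ℝ}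
    (hc : Continuous p) (h0 : ∀ x, 0 ≤ p x) (hb : ∀ x, p x ≤ b) :
    ∃ q : ℝ → ℝ, Continuous q ∧ (∀ x, 0 ≤ q x) ∧ (∀ x, q x ≤ b) ∧
      Measure.conv ν (volume.withDensity fun x => ENNReal.ofReal (p x)) =
        volume.withDensity fun x => ENNReal.ofReal (q x) := by
  have hbd : ∀ x, ‖p x‖ ≤ b := fun x => by rw [Real.norm_eq_abs, abs_of_nonneg (h0 x)]; exact hb x
  have hi : ∀ x, Integrable (fun y => p (x - y)) ν := fun x =>
    (integrable_const b).mono' (by fun_prop) (ae_of_all _ fun y => hbd _)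
  have hq0 : ∀ x, 0 ≤ ∫ y, p (x - y) ∂ν := fun x => integral_nonneg fun y => h0 _
  refine ⟨fun x => ∫ y, p (x - y) ∂ν, ?_, hq0, fun x => ?_, ?_⟩
  · exact continuous_of_dominated (fun x => by fun_prop) (fun x => ae_of_all _ fun y => hbd _)
      (integrable_const b) (ae_of_all _ fun y => by fun_prop)
  · refine (integral_mono (hi x) (integrable_const b) fun y => hb _).trans_eq ?_
    simp
  · ext s hs
    have hm : Measurable fun x => ENNReal.ofReal (p x) := by fun_prop
    rw [← lintegral_indicator_one hs, Measure.lintegral_conv (measurable_one.indicator hs),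
      withDensity_apply _ hs, ← lintegral_indicator hs]
    have e1 : ∀ y : ℝ, ∫⁻ x, s.indicator 1 (y + x)
          ∂(volume.withDensity fun x => ENNReal.ofReal (p x))
        = ∫⁻ x, s.indicator 1 x * ENNReal.ofReal (p (x - y)) := by
      intro y
      rw [lintegral_withDensity_eq_lintegral_mul _ hm
        (g := fun x => s.indicator 1 (y + x))
        ((measurable_one.indicator hs).comp (measurable_const_add y))]
      rw [← lintegral_add_left_eq_self
        (fun x => s.indicator 1 x * ENNReal.ofReal (p (x - y))) y]
      refine lintegral_congr fun x => ?_
      simp [mul_comm]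
    simp_rw [e1]
    rw [lintegral_lintegral_swap]
    · refine lintegral_congr fun x => ?_
      rw [lintegral_const_mul _ (by fun_prop),
        ← ofReal_integral_eq_lintegral_ofReal (hi x) (ae_of_all _ fun y => h0 _)]
      by_cases hx : x ∈ s <;> simp [hx]
    · refine Measurable.aemeasurable ?_
      exact ((measurable_one.indicator hs).comp measurable_snd).mul (by fun_prop)

section

variable {Ω : Type*} [MeasurableSpace Ω] {P : Measure Ω}
  {X : ℕ → Ω → ℝ} {p : ℕ → ℝ → ℝ} {J : ℝ}

lemma IsCenteredSequence.pos (h : IsCenteredSequence P X p J) : 0 < J :=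
  (sq_nonneg _).trans_lt (h.deriv_lt 0)

lemma IsCenteredSequence.integral_abs_deriv_le (h : IsCenteredSequence P X p J) (i : ℕ) :
    ∫ x, |deriv (p i) x| ≤ √J :=
  Real.le_sqrt_of_sq_le (h.deriv_lt i).le

lemma IsCenteredSequence.measurable_sum (h : IsCenteredSequence P X p J) (n : ℕ) :
    Measurable (∑ i ∈ Finset.range n, X i) := by
  rw [show (∑ i ∈ Finset.range n, X i) = fun ω => ∑ i ∈ Finset.range n, X i ω by ext; simp]
  exact Finset.measurable_sum _ fun i _ => h.measurable i

lemma IsCenteredSequence.exists_density_sum [IsProbabilityMeasure P]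
    (h : IsCenteredSequence P X p J) {n : ℕ}
    (hn : 1 ≤ n) : ∃ q : ℝ → ℝ, Continuous q ∧ (∀ x, 0 ≤ q x) ∧ (∀ x, q x ≤ √J) ∧
      P.map (∑ i ∈ Finset.range n, X i) = volume.withDensity fun x => ENNReal.ofReal (q x) := by
  obtain ⟨m, rfl⟩ : ∃ m, n = m + 1 := ⟨n - 1, by omega⟩
  have hms := h.measurable_sum m
  have := Measure.isProbabilityMeasure_map (μ := P) hms.aemeasurable
  have hd := h.density m
  have hi := hd.integrable (h.measurable m)
  have hind := h.indep.indepFun_sum_range_succ h.measurable m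
  rw [Finset.sum_range_succ, hind.map_add_eq_map_conv_map hms (h.measurable m), hd.map_eq]
  exact exists_density_conv (continuous_of_absolutelyContinuous hd.absolutelyContinuous) hd.nonneg
    fun x => (le_integral_abs_deriv hd.absolutelyContinuous hi (h.integrable_deriv m) x).trans
      (h.integral_abs_deriv_le m)

/-! ### Characteristic functions of the summands -/

lemma IsCenteredSequence.norm_charFun_le [IsProbabilityMeasure P]
    (h : IsCenteredSequence P X p J) (i : ℕ) {t : ℝ}
    (ht : t ≠ 0) : ‖charFun (P.map (X i)) t‖ ≤ 6 * √J / |t| := by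
  have hd := h.density i
  refine (norm_charFun_le_div hd.nonneg hd.absolutelyContinuous
    (hd.integrable (h.measurable i)) (h.integrable_deriv i) hd.map_eq ht).trans ?_
  gcongr
  exact h.integral_abs_deriv_le i

/-- The rate of the envelope of the characteristic functions of the summands. -/
noncomputable def envelopeConst (J : ℝ) : ℝ := 1 / (32 * (6 * √J) ^ 2)

lemma envelopeConst_pos (hJ : 0 < J) : 0 < envelopeConst J := by
  have := Real.sqrt_pos.2 hJ
  rw [envelopeConst]; positivity

/-- A bound on the second and third absolute moments of a law with third absolute moment at most
`β`, and of the centered Gaussian law of the same variance. -/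
noncomputable def momentConst (β : ℝ) : ℝ :=
  (2 + β) ^ 2 * (1 + ∫ x, |x| ^ 3 ∂(gaussianReal 0 1))

lemma sq_le_one_add_abs_pow (x : ℝ) : x ^ 2 ≤ 1 + |x| ^ 3 := by
  rw [← sq_abs]
  have := abs_nonneg x
  rcases le_total |x| 1 with h | h <;> nlinarith [pow_nonneg this 3, pow_nonneg this 2]

lemma le_momentConst {β y : ℝ} (hβ : 0 ≤ β) (h : y ≤ 1 + β) : y ≤ momentConst β := by
  have hm : 0 ≤ ∫ x, |x| ^ 3 ∂(gaussianReal 0 1) := integral_nonneg fun x => by positivity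
  rw [momentConst]
  nlinarith [mul_nonneg (sq_nonneg (2 + β)) hm]

lemma integrable_abs_pow_three_gaussianReal (v : ℝ≥0) :
    Integrable (fun x => |x| ^ 3) (gaussianReal 0 v) := by
  have := (memLp_id_gaussianReal (μ := 0) (v := v) 3).integrable_norm_pow (by norm_num)
  simpa using this

lemma integral_sq_gaussianReal (v : ℝ≥0) : ∫ x, x ^ 2 ∂(gaussianReal 0 v) = v := by
  have h := variance_id_gaussianReal (μ := 0) (v := v)
  rw [variance_eq_integral (by fun_prop)] at h
  simpa using h

lemma integral_abs_pow_three_gaussianReal (v : ℝ≥0) :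
    ∫ x, |x| ^ 3 ∂(gaussianReal 0 v) = √v ^ 3 * ∫ x, |x| ^ 3 ∂(gaussianReal 0 1) := by
  have h := gaussianReal_map_const_mul (μ := 0) (v := 1) (√v)
  have e : NNReal.mk (√(v : ℝ) ^ 2) (sq_nonneg _) * 1 = v := by
    ext; simp
  rw [mul_zero, e] at h
  rw [← h, integral_map (by fun_prop) (by fun_prop), ← integral_const_mul]
  refine integral_congr_ae (ae_of_all _ fun x => ?_)
  simp only [abs_mul, abs_of_nonneg (Real.sqrt_nonneg _), mul_pow]

lemma charLike_gaussianReal {κ β : ℝ} (hβ : 0 ≤ β) {v : ℝ≥0} (hκ : κ ≤ v)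
    (hv : (v : ℝ) ≤ 1 + β) : CharLike κ (momentConst β) v (charFun (gaussianReal 0 v)) := by
  refine charLike_charFun (integrable_abs_pow_three_gaussianReal v) (by simp)
    (integral_sq_gaussianReal v) ?_ (le_momentConst hβ hv) fun t => ?_
  · rw [integral_abs_pow_three_gaussianReal, momentConst]
    have hm : 0 ≤ ∫ x, |x| ^ 3 ∂(gaussianReal 0 1) := integral_nonneg fun x => by positivity
    have h1 : √(v : ℝ) ^ 3 ≤ (2 + β) ^ 2 := by
      have h2 : √(v : ℝ) ^ 2 = v := Real.sq_sqrt v.2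
      have h3 : √(v : ℝ) ≤ 2 + β := by
        rw [Real.sqrt_le_left (by linarith)]; nlinarith
      have h4 : 0 ≤ √(v : ℝ) := Real.sqrt_nonneg _
      calc √(v : ℝ) ^ 3 = v * √(v : ℝ) := by rw [pow_succ, h2]
        _ ≤ (2 + β) * (2 + β) := by gcongr; linarith
        _ = _ := by ring
    have h5 := mul_le_mul_of_nonneg_right h1 hm
    nlinarith [sq_nonneg (2 + β)]
  · have h1 : ‖charFun (gaussianReal 0 v) t‖ ^ 2 = Real.exp (-(v * t ^ 2)) := by
      rw [charFun_gaussianReal, norm_exp, ← Real.exp_nat_mul]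
      congr 1
      have : ((t : ℂ) * (0 : ℝ) * I - v * t ^ 2 / 2) = ((-(v * t ^ 2 / 2) : ℝ) : ℂ) := by
        push_cast; ring
      rw [this, ofReal_re]; push_cast; ring
    rw [h1, Real.exp_neg, inv_mul_le_one₀ (Real.exp_pos _)]
    have := Real.add_one_le_exp (v * t ^ 2)
    nlinarith [mul_le_mul_of_nonneg_right hκ (sq_nonneg t)]

lemma IsCenteredSequence.integral_sq (h : IsCenteredSequence P X p J) (i : ℕ) :
    ∫ x, x ^ 2 ∂(P.map (X i)) = variance (X i) P := by
  rw [variance_of_integral_eq_zero (h.measurable i).aemeasurable (h.centered i),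
    integral_map (h.measurable i).aemeasurable (by fun_prop)]

lemma integrable_abs_pow_three_map {Y : Ω → ℝ} (hY : Measurable Y)
    (h3 : Integrable (fun ω => |Y ω| ^ 3) P) : Integrable (fun x => |x| ^ 3) (P.map Y) :=
  (integrable_map_measure (by fun_prop) hY.aemeasurable).2 h3

lemma IsCenteredSequence.variance_le_one_add [IsProbabilityMeasure P]
    (h : IsCenteredSequence P X p J) {β : ℝ} (i : ℕ)
    (h3 : Integrable (fun ω => |X i ω| ^ 3) P) (hβ : ∫ ω, |X i ω| ^ 3 ∂P ≤ β) :
    variance (X i) P ≤ 1 + β := by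
  have := Measure.isProbabilityMeasure_map (μ := P) (h.measurable i).aemeasurable
  have hi := integrable_abs_pow_three_map (h.measurable i) h3
  have hsq : Integrable (fun x : ℝ => x ^ 2) (P.map (X i)) := (memLp_id_two hi).integrable_sq
  rw [← h.integral_sq i]
  refine (integral_mono hsq ((integrable_const 1).add hi) sq_le_one_add_abs_pow).trans ?_
  simp only [Pi.add_apply]
  rw [integral_add (integrable_const 1) hi, integral_const, probReal_univ, one_smul,
    integral_map (h.measurable i).aemeasurable (by fun_prop)]
  linarith

lemma IsCenteredSequence.envelopeConst_le_variance [IsProbabilityMeasure P]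
    (h : IsCenteredSequence P X p J) (i : ℕ)
    (h3 : Integrable (fun ω => |X i ω| ^ 3) P) : envelopeConst J ≤ variance (X i) P := by
  have := Measure.isProbabilityMeasure_map (μ := P) (h.measurable i).aemeasurable
  have hi := integrable_abs_pow_three_map (h.measurable i) h3
  rw [← h.integral_sq i]
  exact one_div_le_integral_sq (by have := Real.sqrt_pos.2 h.pos; positivity)
    (fun t ht => h.norm_charFun_le i ht) (memLp_id_two hi).integrable_sq

lemma IsCenteredSequence.charLike [IsProbabilityMeasure P]
    (h : IsCenteredSequence P X p J) {β : ℝ} (i : ℕ)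
    (h3 : Integrable (fun ω => |X i ω| ^ 3) P) (hβ : ∫ ω, |X i ω| ^ 3 ∂P ≤ β) :
    CharLike (envelopeConst J) (momentConst β) (variance (X i) P) (charFun (P.map (X i))) := by
  have := Measure.isProbabilityMeasure_map (μ := P) (h.measurable i).aemeasurable
  have hβ0 : 0 ≤ β := (integral_nonneg fun ω => by positivity).trans hβ
  refine charLike_charFun (integrable_abs_pow_three_map (h.measurable i) h3) ?_ (h.integral_sq i)
    ?_ (le_momentConst hβ0 (h.variance_le_one_add i h3 hβ)) ?_
  · rw [integral_map (h.measurable i).aemeasurable (by fun_prop)]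
    exact h.centered i
  · rw [integral_map (h.measurable i).aemeasurable (by fun_prop)]
    exact le_momentConst hβ0 (by linarith)
  · exact sq_norm_charFun_mul_le_one (by have := Real.sqrt_pos.2 h.pos; positivity)
      fun t ht => h.norm_charFun_le i ht

lemma IsCenteredSequence.charFun_sum [IsProbabilityMeasure P]
    (h : IsCenteredSequence P X p J) (n : ℕ) :
    charFun (P.map (∑ i ∈ Finset.range n, X i)) =
      fun t => ∏ i ∈ Finset.range n, charFun (P.map (X i)) t := by
  rw [iIndepFun.charFun_map_finsetSum_eq_prod (fun i _ => (h.measurable i).aemeasurable)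
    (iIndepFun.precomp
      (g := ((↑) : Finset.range n → ℕ)) Subtype.val_injective h.indep)]
  ext t
  simp

lemma charFun_gaussianReal_sum (v : ℕ → ℝ≥0) (n : ℕ) :
    charFun (gaussianReal 0 (∑ i ∈ Finset.range n, v i)) =
      fun t => ∏ i ∈ Finset.range n, charFun (gaussianReal 0 (v i)) t := by
  ext t
  simp_rw [charFun_gaussianReal]
  rw [← Complex.exp_sum]
  congr 1
  simp [Finset.sum_neg_distrib, Finset.sum_mul, Finset.sum_div]

/-! ### The sum is close to Gaussian in total variation -/

lemma integrable_sq_mul_of_withDensity {q : ℝ → ℝ} (hq : Continuous q) (h0 : ∀ x, 0 ≤ q x)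
    (h2 : Integrable (fun x : ℝ => x ^ 2) (volume.withDensity fun x => ENNReal.ofReal (q x))) :
    Integrable fun x => x ^ 2 * q x := by
  rw [integrable_withDensity_iff (by fun_prop) (by simp)] at h2
  simpa [h0] using h2

lemma integrable_of_withDensity {q : ℝ → ℝ} (hq : Continuous q) (h0 : ∀ x, 0 ≤ q x)
    [IsProbabilityMeasure (volume.withDensity fun x => ENNReal.ofReal (q x))] :
    Integrable q := by
  have := integrable_const (μ := volume.withDensity fun x => ENNReal.ofReal (q x)) (1 : ℝ)
  rw [integrable_withDensity_iff (by fun_prop) (by simp)] at this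
  simpa [h0] using this

lemma integral_eq_one_of_withDensity {q : ℝ → ℝ} (hq : Continuous q) (h0 : ∀ x, 0 ≤ q x)
    [IsProbabilityMeasure (volume.withDensity fun x => ENNReal.ofReal (q x))] :
    ∫ x, q x = 1 := by
  have := integral_withDensity_ofReal hq.measurable h0 (fun _ => (1 : ℝ))
  simpa using this.symm

lemma gaussianReal_eq_withDensity {v : ℝ≥0} (hv : v ≠ 0) : gaussianReal 0 v =
    volume.withDensity fun x => ENNReal.ofReal (gaussianPDFReal 0 v x) := by
  rw [gaussianReal_of_var_ne_zero _ hv]; rfl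

lemma continuous_gaussianPDFReal (v : ℝ≥0) : Continuous (gaussianPDFReal 0 v) := by
  unfold gaussianPDFReal; fun_prop

lemma IsCenteredSequence.memLp_two [IsProbabilityMeasure P]
    (h : IsCenteredSequence P X p J)
    (h3 : ∀ i, Integrable (fun ω => |X i ω| ^ 3) P) (i : ℕ) : MemLp (X i) 2 P := by
  have := Measure.isProbabilityMeasure_map (μ := P) (h.measurable i).aemeasurable
  have := memLp_id_two (integrable_abs_pow_three_map (h.measurable i) (h3 i))
  exact (memLp_map_measure_iff (by fun_prop) (h.measurable i).aemeasurable).1 this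

/-- The constant of the total variation estimate for the sum. The term `8` covers `n < 11`, where
the `L¹` distance is only known to be at most `2`. -/
noncomputable def sumConst (J β : ℝ) : ℝ :=
  2 * π * totalVariationConst (envelopeConst J) (momentConst β) + 8

lemma sumConst_pos (hJ : 0 < J) {β : ℝ} (hβ : 0 ≤ β) : 0 < sumConst J β := by
  have h1 := envelopeConst_pos hJ
  have h2 : 0 ≤ momentConst β := by
    have := le_momentConst hβ le_rfl; linarith
  rw [sumConst, totalVariationConst]; positivity

/-- The density `q` of the sum is within `O (1 / √n)` of the Gaussian density in `L¹`. -/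
lemma IsCenteredSequence.integral_abs_sub_le [IsProbabilityMeasure P]
    (h : IsCenteredSequence P X p J) {β : ℝ}
    (h3 : ∀ i, Integrable (fun ω => |X i ω| ^ 3) P) (hβ : ∀ i, ∫ ω, |X i ω| ^ 3 ∂P ≤ β) {n : ℕ}
    (hn : 1 ≤ n) {q : ℝ → ℝ} (hq : Continuous q) (hq0 : ∀ x, 0 ≤ q x)
    (hS : P.map (∑ i ∈ Finset.range n, X i) = volume.withDensity fun x => ENNReal.ofReal (q x)) :
    ∫ x, |q x - gaussianPDFReal 0 (sumVar P X n).toNNReal x| ≤ 2 ∧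
    ∫ x, |q x - gaussianPDFReal 0 (sumVar P X n).toNNReal x| ≤ sumConst J β / √n := by
  have hβ0 : 0 ≤ β := (integral_nonneg fun ω => by positivity).trans (hβ 0)
  have hκ := envelopeConst_pos h.pos
  set κ := envelopeConst J
  set C := momentConst β with hC
  have hv : ∀ i, κ ≤ variance (X i) P := fun i => h.envelopeConst_le_variance i (h3 i)
  set V : ℝ≥0 := (sumVar P X n).toNNReal with hV
  have hVsum : V = ∑ i ∈ Finset.range n, (variance (X i) P).toNNReal := by
    rw [hV, sumVar, Real.toNNReal_sum_of_nonneg fun i _ => variance_nonneg _ _]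
  have hV0 : V ≠ 0 := by
    have : 0 < sumVar P X n := by
      refine Finset.sum_pos (fun i _ => hκ.trans_le (hv i)) ?_
      simp only [Finset.nonempty_range_iff]; omega
    simpa [hV] using this
  set φ := gaussianPDFReal 0 V with hφ
  have hφc : Continuous φ := continuous_gaussianPDFReal V
  have hφ0 : ∀ x, 0 ≤ φ x := gaussianPDFReal_nonneg 0 V
  have hG : gaussianReal 0 V = volume.withDensity fun x => ENNReal.ofReal (φ x) :=
    gaussianReal_eq_withDensity hV0
  have hms := h.measurable_sum n
  have hSp := Measure.isProbabilityMeasure_map (μ := P) hms.aemeasurable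
  have hGp : IsProbabilityMeasure (gaussianReal 0 V) := inferInstance
  have hS2 : MemLp id 2 (P.map (∑ i ∈ Finset.range n, X i)) :=
    (memLp_map_measure_iff (by fun_prop) hms.aemeasurable).2
      (by simpa using memLp_finsetSum' (Finset.range n) fun i _ => h.memLp_two h3 i)
  have hG2 : MemLp id 2 (gaussianReal 0 V) := memLp_id_gaussianReal 2
  have dS := deriv_deriv_charFun hS2
  have dG := deriv_deriv_charFun hG2
  have cS := fun t => charFun_apply_real (μ := P.map (∑ i ∈ Finset.range n, X i)) t
  have cG := fun t => charFun_apply_real (μ := gaussianReal 0 V) t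
  have eS := h.charFun_sum n
  have eG := charFun_gaussianReal_sum (fun i => (variance (X i) P).toNNReal) n
  rw [← hVsum] at eG
  have hS2i : Integrable (fun x : ℝ => x ^ 2) (P.map (∑ i ∈ Finset.range n, X i)) :=
    hS2.integrable_sq
  have hG2i : Integrable (fun x : ℝ => x ^ 2) (gaussianReal 0 V) := hG2.integrable_sq
  rw [eS] at dS cS
  rw [eG] at dG cG
  rw [hS] at hSp dS cS hS2i
  rw [hG] at hGp dG cG hG2i
  have iq := integrable_of_withDensity hq hq0
  have iφ := integrable_of_withDensity hφc hφ0
  have iq2 := integrable_sq_mul_of_withDensity hq hq0 hS2i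
  have iφ2 := integrable_sq_mul_of_withDensity hφc hφ0 hG2i
  have hq1 := integral_eq_one_of_withDensity hq hq0
  have hφ1 := integral_eq_one_of_withDensity hφc hφ0
  have hle2 : ∫ x, |q x - φ x| ≤ 2 := by
    calc _ ≤ ∫ x, (q x + φ x) := integral_mono (iq.sub iφ).abs (iq.add iφ) fun x => by
          have := hq0 x; have := hφ0 x
          simp only [Pi.sub_apply]
          rw [abs_le]; constructor <;> linarith
      _ = 2 := by rw [integral_add iq iφ, hq1, hφ1]; norm_num
  refine ⟨hle2, ?_⟩
  have hn0 : (0 : ℝ) < n := by exact_mod_cast hn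
  have hTV : 0 ≤ totalVariationConst κ C := by
    have : 0 ≤ C := by have := le_momentConst hβ0 le_rfl; linarith
    rw [totalVariationConst]; positivity
  rcases lt_or_ge n 11 with hn11 | hn11
  · refine hle2.trans ?_
    rw [le_div_iff₀ (by positivity), sumConst]
    have h4 : √(n : ℝ) ≤ 4 := by
      rw [Real.sqrt_le_left (by norm_num)]
      have : (n : ℝ) < 11 := by exact_mod_cast hn11
      linarith
    have := mul_nonneg Real.two_pi_pos.le hTV
    linarith
  · have hexp : ∀ (g : ℝ → ℝ) (t : ℝ), Integrable g →
        Integrable fun x : ℝ => cexp (t * x * I) * (g x : ℂ) := fun g t hg =>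
      hg.ofReal.bdd_mul (c := 1) (by fun_prop) (ae_of_all _ fun x => by
        rw [← ofReal_mul, norm_exp_ofReal_mul_I])
    have hmain := integral_abs_le_of_charLike hκ
      (fun i => h.charLike i (h3 i) (hβ i))
      (g := fun i => charFun (gaussianReal 0 (variance (X i) P).toNNReal))
      (fun i => by
        have hvi := variance_nonneg (X i) P
        have := charLike_gaussianReal (κ := κ) hβ0 (v := (variance (X i) P).toNNReal)
          (by rw [Real.coe_toNNReal _ hvi]; exact hv i)
          (by rw [Real.coe_toNNReal _ hvi]; exact h.variance_le_one_add i (h3 i) (hβ i))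
        rwa [Real.coe_toNNReal _ hvi] at this) hn11 (u := fun x => q x - φ x) (by fun_prop)
      (iq.sub iφ) (by simp only [mul_sub]; exact iq2.sub iφ2) (fun t => ?_) (fun t => ?_)
    · refine hmain.trans ?_
      rw [sumConst]
      gcongr
      linarith
    · have h1 := cS t
      have h2 := cG t
      rw [integral_withDensity_ofReal hq.measurable hq0] at h1
      rw [integral_withDensity_ofReal hφc.measurable hφ0] at h2
      beta_reduce at h1 h2
      rw [h1, h2, ← integral_sub]
      · refine integral_congr_ae (ae_of_all _ fun x => ?_)
        simp only [real_smul]; push_cast; ring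
      · simpa only [real_smul, mul_comm] using hexp q t iq
      · simpa only [real_smul, mul_comm] using hexp φ t iφ
    · have h1 := dS t
      have h2 := dG t
      rw [integral_withDensity_ofReal hq.measurable hq0] at h1
      rw [integral_withDensity_ofReal hφc.measurable hφ0] at h2
      rw [h1, h2, ← sub_eq_zero]
      have j1 := hexp _ t iq2
      have j2 := hexp _ t iφ2
      have e1 : ∫ x : ℝ, (q x) • ((x : ℂ) ^ 2 * cexp (t * x * I))
          = ∫ x : ℝ, cexp (t * x * I) * ((x ^ 2 * q x : ℝ) : ℂ) := by
        refine integral_congr_ae (ae_of_all _ fun x => ?_)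
        simp only [real_smul]; push_cast; ring
      have e2 : ∫ x : ℝ, (φ x) • ((x : ℂ) ^ 2 * cexp (t * x * I))
          = ∫ x : ℝ, cexp (t * x * I) * ((x ^ 2 * φ x : ℝ) : ℂ) := by
        refine integral_congr_ae (ae_of_all _ fun x => ?_)
        simp only [real_smul]; push_cast; ring
      have e3 : ∫ x : ℝ, cexp (t * x * I) * ((x ^ 2 * (q x - φ x) : ℝ) : ℂ)
          = (∫ x : ℝ, cexp (t * x * I) * ((x ^ 2 * q x : ℝ) : ℂ))
            - ∫ x : ℝ, cexp (t * x * I) * ((x ^ 2 * φ x : ℝ) : ℂ) := by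
        rw [← integral_sub j1 j2]
        refine integral_congr_ae (ae_of_all _ fun x => ?_)
        simp only; push_cast; ring
      rw [e1, e2, e3]
      ring

end

end EntropicCLT

namespace EntropicCLT

open Filter Topology InformationTheory
open scoped Real NNReal ENNReal

/-! ### Relative entropy and total variation -/

/-- The integrand of the relative entropy is controlled by `|a - c|`, and the logarithm of the
ratio of the densities enters only where `a` exceeds `c`. -/
lemma mul_klFun_div_le {a c L : ℝ} (ha : 0 ≤ a) (hc : 0 < c) (hL : 0 < a → Real.log (a / c) ≤ L) :
    c * klFun (a / c) ≤ |a - c| + max (a - c) 0 * L := by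
  have e : c * klFun (a / c) = a * Real.log (a / c) + c - a := by
    rw [klFun_apply]; field_simp
  rw [e]
  rcases ha.eq_or_lt with rfl | ha
  · simp [abs_of_pos hc, hc.le]
  rcases le_or_gt a c with h | h
  · have h1 : Real.log (a / c) ≤ 0 := Real.log_nonpos (by positivity) ((div_le_one hc).2 h)
    have h2 : a * Real.log (a / c) ≤ 0 := mul_nonpos_of_nonneg_of_nonpos ha.le h1
    rw [max_eq_right (by linarith), abs_of_nonpos (by linarith)]
    linarith
  · rw [max_eq_left (by linarith), abs_of_pos (by linarith)]
    have h1 := Real.log_le_sub_one_of_pos (show 0 < a / c by positivity)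
    have h2 : c * Real.log (a / c) ≤ a - c := by
      calc _ ≤ c * (a / c - 1) := by gcongr
        _ = a - c := by field_simp
    have h3 : (a - c) * Real.log (a / c) ≤ (a - c) * L :=
      mul_le_mul_of_nonneg_left (hL ha) (by linarith)
    linarith

lemma log_div_gaussianPDFReal_le {v : ℝ≥0} (hv : v ≠ 0) {a b : ℝ} (ha : 0 < a) (hab : a ≤ b)
    (x : ℝ) : Real.log (a / gaussianPDFReal 0 v x) ≤
      max 0 (Real.log (b * √(2 * π * v))) + x ^ 2 / (2 * v) := by
  have hv0 : (0 : ℝ) < v := by positivity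
  have h2 : gaussianPDFReal 0 v x = (√(2 * π * v))⁻¹ * Real.exp (-(x ^ 2 / (2 * v))) := by
    rw [gaussianPDFReal, sub_zero, neg_div]
  have h3 : a / gaussianPDFReal 0 v x = a * √(2 * π * v) * Real.exp (x ^ 2 / (2 * v)) := by
    rw [h2, Real.exp_neg]; field_simp
  rw [h3, Real.log_mul (by positivity) (by positivity), Real.log_exp]
  gcongr
  refine le_max_of_le_right (Real.log_le_log (by positivity) ?_)
  gcongr

lemma klDiv_withDensity_eq {q φ : ℝ → ℝ} (hq : Continuous q) (hφ : Continuous φ)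
    (hq0 : ∀ x, 0 ≤ q x) (hφ0 : ∀ x, 0 < φ x)
    [IsProbabilityMeasure (volume.withDensity fun x => ENNReal.ofReal (q x))]
    [IsProbabilityMeasure (volume.withDensity fun x => ENNReal.ofReal (φ x))] :
    klDiv (volume.withDensity fun x => ENNReal.ofReal (q x))
        (volume.withDensity fun x => ENNReal.ofReal (φ x)) =
      ∫⁻ x, ENNReal.ofReal (φ x * klFun (q x / φ x)) := by
  set μ := volume.withDensity fun x => ENNReal.ofReal (q x) with hμ
  set γ := volume.withDensity fun x => ENNReal.ofReal (φ x) with hγ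
  have hφm : Measurable fun x => ENNReal.ofReal (φ x) := by fun_prop
  have hvol : volume ≪ γ :=
    withDensity_absolutelyContinuous' hφm.aemeasurable (ae_of_all _ fun x => by simp [hφ0 x])
  have hac : μ ≪ γ := (withDensity_absolutelyContinuous _ _).trans hvol
  have h1 : μ.rnDeriv γ =ᵐ[volume] fun x => ENNReal.ofReal (q x) / ENNReal.ofReal (φ x) := by
    have e1 := Measure.rnDeriv_withDensity_right μ volume hφm.aemeasurable
      (ae_of_all _ fun x => by simp [hφ0 x]) (ae_of_all _ fun x => by simp)
    have e2 := Measure.rnDeriv_withDensity (volume : Measure ℝ)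
      (f := fun x => ENNReal.ofReal (q x)) (by fun_prop)
    filter_upwards [e1, e2] with x h1 h2
    rw [h1, h2, ENNReal.div_eq_inv_mul]
  rw [klDiv_eq_lintegral_klFun_of_ac hac, lintegral_withDensity_eq_lintegral_mul₀ hφm.aemeasurable
    (by fun_prop)]
  refine lintegral_congr_ae ?_
  filter_upwards [h1] with x hx
  simp only [Pi.mul_apply]
  rw [hx, ← ENNReal.ofReal_div_of_pos (hφ0 x),
    ENNReal.toReal_ofReal (div_nonneg (hq0 x) (hφ0 x).le), ENNReal.ofReal_mul (hφ0 x).le]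

/-- Hölder's inequality between the masses of `d` and `|x| ^ k * d`. -/
lemma integral_sq_mul_le {d : ℝ → ℝ} (hd : Continuous d) (hd0 : ∀ x, 0 ≤ d x) (hi : Integrable d)
    {k : ℝ} (hk : 2 ≤ k) (hik : Integrable fun x => |x| ^ k * d x) :
    ∫ x, x ^ 2 * d x ≤ (∫ x, d x) ^ (1 - 2 / k) * (∫ x, |x| ^ k * d x) ^ (2 / k) := by
  have hk0 : 0 < k := by linarith
  have h2k : 2 / k ≤ 1 := (div_le_one hk0).2 hk
  have hdk0 : ∀ x, 0 ≤ |x| ^ k * d x := fun x =>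
    mul_nonneg (Real.rpow_nonneg (abs_nonneg x) k) (hd0 x)
  have h := ENNReal.lintegral_mul_norm_pow_le (μ := volume)
    (f := fun x => ENNReal.ofReal (d x)) (g := fun x => ENNReal.ofReal (|x| ^ k * d x))
    (by fun_prop) (hik.1.aemeasurable.ennreal_ofReal) (p := 1 - 2 / k) (q := 2 / k)
    (by linarith) (by positivity) (by ring)
  rw [← ofReal_integral_eq_lintegral_ofReal hi (ae_of_all _ hd0),
    ← ofReal_integral_eq_lintegral_ofReal hik (ae_of_all _ hdk0),
    ENNReal.ofReal_rpow_of_nonneg (integral_nonneg hd0) (by linarith),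
    ENNReal.ofReal_rpow_of_nonneg (integral_nonneg hdk0) (by positivity),
    ← ENNReal.ofReal_mul (Real.rpow_nonneg (integral_nonneg hd0) _)] at h
  have hpt : ∀ x, ENNReal.ofReal (d x) ^ (1 - 2 / k) * ENNReal.ofReal (|x| ^ k * d x) ^ (2 / k)
      = ENNReal.ofReal (x ^ 2 * d x) := by
    intro x
    rw [ENNReal.ofReal_rpow_of_nonneg (hd0 x) (by linarith),
      ENNReal.ofReal_rpow_of_nonneg (hdk0 x) (by positivity),
      ← ENNReal.ofReal_mul (Real.rpow_nonneg (hd0 x) _)]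
    congr 1
    rw [Real.mul_rpow (Real.rpow_nonneg (abs_nonneg x) k) (hd0 x), ← Real.rpow_mul (abs_nonneg x),
      mul_div_cancel₀ _ hk0.ne', Real.rpow_two, sq_abs, mul_left_comm,
      ← Real.rpow_add_of_nonneg (hd0 x) (by linarith) (by positivity), sub_add_cancel,
      Real.rpow_one]
  simp_rw [hpt] at h
  have hnn : 0 ≤ (∫ x, d x) ^ (1 - 2 / k) * (∫ x, |x| ^ k * d x) ^ (2 / k) :=
    mul_nonneg (Real.rpow_nonneg (integral_nonneg hd0) _)
      (Real.rpow_nonneg (integral_nonneg hdk0) _)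
  rw [integral_eq_lintegral_of_nonneg_ae (ae_of_all _ fun x => mul_nonneg (sq_nonneg x) (hd0 x))
    (by fun_prop)]
  exact ENNReal.toReal_le_of_le_ofReal hnn h

/-- The relative entropy of a bounded density with respect to a Gaussian, in terms of the total
variation distance and of a moment. -/
lemma klDiv_gaussianReal_le {q : ℝ → ℝ} (hq : Continuous q) (hq0 : ∀ x, 0 ≤ q x) {b : ℝ}
    (hb : ∀ x, q x ≤ b) [IsProbabilityMeasure (volume.withDensity fun x => ENNReal.ofReal (q x))]
    {v : ℝ≥0} (hv : v ≠ 0) {k : ℝ} (hk : 2 ≤ k) (hik : Integrable fun x => |x| ^ k * q x)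
    {T : ℝ} (hT : T = ∫ x, |q x - gaussianPDFReal 0 v x|) :
    klDiv (volume.withDensity fun x => ENNReal.ofReal (q x)) (gaussianReal 0 v) ≤
      ENNReal.ofReal ((1 + max 0 (Real.log (b * √(2 * π * v)))) * T +
        T ^ (1 - 2 / k) * ((∫ x, |x| ^ k * q x) / (v : ℝ) ^ (k / 2)) ^ (2 / k)) := by
  have hv0 : (0 : ℝ) < v := by positivity
  have hk0 : 0 < k := by linarith
  have h2k : 2 / k ≤ 1 := (div_le_one hk0).2 hk
  set φ := gaussianPDFReal 0 v with hφ
  have hφc : Continuous φ := continuous_gaussianPDFReal v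
  have hφ0 : ∀ x, 0 < φ x := fun x => gaussianPDFReal_pos 0 v x hv
  have hG : gaussianReal 0 v = volume.withDensity fun x => ENNReal.ofReal (φ x) :=
    gaussianReal_eq_withDensity hv
  have hGp : IsProbabilityMeasure (gaussianReal 0 v) := inferInstance
  rw [hG] at hGp ⊢
  have iq := integrable_of_withDensity hq hq0
  have iφ := integrable_of_withDensity hφc fun x => (hφ0 x).le
  set Λ := max 0 (Real.log (b * √(2 * π * v))) with hΛ
  have hΛ0 : 0 ≤ Λ := le_max_left _ _
  set d : ℝ → ℝ := fun x => max (q x - φ x) 0 with hd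
  have hdc : Continuous d := by fun_prop
  have hd0 : ∀ x, 0 ≤ d x := fun x => le_max_right _ _
  have hdq : ∀ x, d x ≤ q x := fun x => max_le (by have := hφ0 x; linarith) (hq0 x)
  have hda : ∀ x, d x ≤ |q x - φ x| := fun x => max_le (le_abs_self _) (abs_nonneg _)
  have hkpos : ∀ x : ℝ, 0 ≤ |x| ^ k := fun x => Real.rpow_nonneg (abs_nonneg x) k
  have hcont : Continuous fun x : ℝ => |x| ^ k :=
    continuous_abs.rpow_const fun x => Or.inr hk0.le
  have id1 : Integrable d := iq.mono' (by fun_prop) (ae_of_all _ fun x => by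
    rw [Real.norm_eq_abs, abs_of_nonneg (hd0 x)]; exact hdq x)
  have idk : Integrable fun x => |x| ^ k * d x := hik.mono' (by fun_prop)
    (ae_of_all _ fun x => by
      rw [Real.norm_eq_abs, abs_of_nonneg (mul_nonneg (hkpos x) (hd0 x))]
      exact mul_le_mul_of_nonneg_left (hdq x) (hkpos x))
  have id2 : Integrable fun x => x ^ 2 * d x := (id1.add idk).mono' (by fun_prop)
    (ae_of_all _ fun x => by
      rw [Real.norm_eq_abs, abs_of_nonneg (mul_nonneg (sq_nonneg x) (hd0 x))]
      have h1 : x ^ 2 ≤ 1 + |x| ^ k := by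
        rcases le_total |x| 1 with h | h
        · have := hkpos x
          rw [← sq_abs]
          have := pow_le_one₀ (n := 2) (abs_nonneg x) h
          linarith
        · have := Real.rpow_le_rpow_of_exponent_le h hk
          rw [Real.rpow_two, sq_abs] at this
          linarith
      have := mul_le_mul_of_nonneg_right h1 (hd0 x)
      simp only [Pi.add_apply]
      linarith)
  have hpt : ∀ x, φ x * klFun (q x / φ x) ≤
      |q x - φ x| + (Λ * d x + (2 * (v : ℝ))⁻¹ * (x ^ 2 * d x)) := by
    intro x
    refine (mul_klFun_div_le (hq0 x) (hφ0 x)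
      fun ha => log_div_gaussianPDFReal_le hv ha (hb x) x).trans_eq ?_
    simp only [hd, div_eq_mul_inv]
    ring
  have iabs : Integrable fun x => |q x - φ x| := (iq.sub iφ).abs
  have hint1 : Integrable fun x => Λ * d x + (2 * (v : ℝ))⁻¹ * (x ^ 2 * d x) :=
    (id1.const_mul Λ).add (id2.const_mul _)
  have hint : Integrable fun x => |q x - φ x| + (Λ * d x + (2 * (v : ℝ))⁻¹ * (x ^ 2 * d x)) :=
    iabs.add hint1
  have hT0 : 0 ≤ T := by rw [hT]; exact integral_nonneg fun x => abs_nonneg _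
  have hdT : ∫ x, d x ≤ T := by
    rw [hT]; exact integral_mono id1 iabs hda
  have hqk0 : 0 ≤ ∫ x, |x| ^ k * q x := integral_nonneg fun x => mul_nonneg (hkpos x) (hq0 x)
  rw [klDiv_withDensity_eq hq hφc hq0 hφ0]
  calc ∫⁻ x, ENNReal.ofReal (φ x * klFun (q x / φ x))
      ≤ ∫⁻ x, ENNReal.ofReal (|q x - φ x| + (Λ * d x + (2 * (v : ℝ))⁻¹ * (x ^ 2 * d x))) :=
        lintegral_mono fun x => ENNReal.ofReal_le_ofReal (hpt x)
    _ = ENNReal.ofReal (∫ x, |q x - φ x| + (Λ * d x + (2 * (v : ℝ))⁻¹ * (x ^ 2 * d x))) := by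
        rw [ofReal_integral_eq_lintegral_ofReal hint (ae_of_all _ fun x => ?_)]
        have := hd0 x
        positivity
    _ ≤ _ := by
        refine ENNReal.ofReal_le_ofReal ?_
        have e1 : ∫ x, |q x - φ x| + (Λ * d x + (2 * (v : ℝ))⁻¹ * (x ^ 2 * d x))
            = T + (Λ * ∫ x, d x) + (2 * (v : ℝ))⁻¹ * ∫ x, x ^ 2 * d x := by
          rw [integral_add iabs hint1, integral_add (id1.const_mul Λ) (id2.const_mul _),
            integral_const_mul,
            integral_const_mul, ← hT]
          ring
        have e2 : ∫ x, x ^ 2 * d x ≤ T ^ (1 - 2 / k) * (∫ x, |x| ^ k * q x) ^ (2 / k) := by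
          refine (integral_sq_mul_le hdc hd0 id1 hk idk).trans ?_
          have h3 : 0 ≤ ∫ x, d x := integral_nonneg fun x => hd0 x
          have h4 : 0 ≤ ∫ x, |x| ^ k * d x := integral_nonneg fun x => mul_nonneg (hkpos x) (hd0 x)
          have h5 : ∫ x, |x| ^ k * d x ≤ ∫ x, |x| ^ k * q x :=
            integral_mono idk hik fun x => mul_le_mul_of_nonneg_left (hdq x) (hkpos x)
          have h6 : 0 ≤ 1 - 2 / k := by linarith
          gcongr
        have e3 : ((v : ℝ) ^ (k / 2)) ^ (2 / k) = v := by
          rw [← Real.rpow_mul hv0.le, show k / 2 * (2 / k) = 1 by field_simp, Real.rpow_one]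
        have e4 : 0 ≤ T ^ (1 - 2 / k) * (∫ x, |x| ^ k * q x) ^ (2 / k) := by positivity
        rw [e1, Real.div_rpow hqk0 (by positivity), e3]
        have e5 : (2 * (v : ℝ))⁻¹ * ∫ x, x ^ 2 * d x
            ≤ (v : ℝ)⁻¹ * (T ^ (1 - 2 / k) * (∫ x, |x| ^ k * q x) ^ (2 / k)) := by
          have h7 : (2 * (v : ℝ))⁻¹ ≤ (v : ℝ)⁻¹ := inv_anti₀ hv0 (by linarith)
          exact mul_le_mul h7 e2 (integral_nonneg fun x => mul_nonneg (sq_nonneg x) (hd0 x))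
            (by positivity)
        have e6 := mul_le_mul_of_nonneg_left hdT hΛ0
        rw [← mul_div_assoc, div_eq_inv_mul]
        linarith

end EntropicCLT

namespace EntropicCLT

open Filter Topology InformationTheory
open scoped Real NNReal ENNReal

/-! ### Moments of the sum -/

lemma abs_pow_three_le_one_add_rpow {k : ℝ} (hk : 3 ≤ k) (x : ℝ) : |x| ^ 3 ≤ 1 + |x| ^ k := by
  have h0 : 0 ≤ |x| ^ k := Real.rpow_nonneg (abs_nonneg x) k
  rcases le_total |x| 1 with h | h
  · have := pow_le_one₀ (n := 3) (abs_nonneg x) h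
    linarith
  · have := Real.rpow_le_rpow_of_exponent_le h hk
    rw [show (3 : ℝ) = ((3 : ℕ) : ℝ) by norm_num, Real.rpow_natCast] at this
    linarith

section

variable {Ω : Type*} [MeasurableSpace Ω] {P : Measure Ω} {X : ℕ → Ω → ℝ} {p : ℕ → ℝ → ℝ}
  {J M k : ℝ}

lemma MomentBound.nonneg (hM : MomentBound P X k M) : 0 ≤ M :=
  (integral_nonneg fun ω => Real.rpow_nonneg (abs_nonneg (X 0 ω)) k).trans (hM 0).2

lemma MomentBound.integrable_abs_pow_three [IsProbabilityMeasure P] (hM : MomentBound P X k M)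
    (hX : ∀ i, Measurable (X i)) (hk : 3 ≤ k) (i : ℕ) : Integrable (fun ω => |X i ω| ^ 3) P := by
  have hm := hX i
  refine ((integrable_const 1).add (hM i).1).mono' (by fun_prop) (ae_of_all _ fun ω => ?_)
  rw [Real.norm_eq_abs, abs_of_nonneg (by positivity)]
  exact abs_pow_three_le_one_add_rpow hk _

lemma MomentBound.integral_abs_pow_three_le [IsProbabilityMeasure P] (hM : MomentBound P X k M)
    (hX : ∀ i, Measurable (X i)) (hk : 3 ≤ k) (i : ℕ) : ∫ ω, |X i ω| ^ 3 ∂P ≤ 1 + M := by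
  refine (integral_mono (hM.integrable_abs_pow_three hX hk i)
    ((integrable_const 1).add (hM i).1) fun ω => abs_pow_three_le_one_add_rpow hk _).trans ?_
  simp only [Pi.add_apply]
  rw [integral_add (integrable_const 1) (hM i).1, integral_const, probReal_univ, one_smul]
  linarith [(hM i).2]

lemma MomentBound.integrable_abs_sum_rpow (hM : MomentBound P X k M)
    (hX : ∀ i, Measurable (X i)) (hk : 3 ≤ k) (n : ℕ) :
    Integrable (fun ω => |∑ i ∈ Finset.range n, X i ω| ^ k) P := by
  have hk0 : 0 < k := by linarith
  have h0 : ENNReal.ofReal k ≠ 0 := by simpa using hk0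
  have hmem : ∀ i, MemLp (X i) (ENNReal.ofReal k) P := fun i => by
    rw [← integrable_norm_rpow_iff (hX i).aestronglyMeasurable h0 (by simp),
      ENNReal.toReal_ofReal hk0.le]
    exact (hM i).1
  have := (memLp_finsetSum (Finset.range n) fun i _ => hmem i).integrable_norm_rpow h0 (by simp)
  rwa [ENNReal.toReal_ofReal hk0.le] at this

/-! ### Bounds on the Lyapunov ratio -/

lemma lyapunov_three : lyapunov P X 3 = fun n =>
    (∑ i ∈ Finset.range n, ∫ ω, |X i ω| ^ 3 ∂P) / sumVar P X n ^ ((3 : ℝ) / 2) := by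
  ext n
  simp only [lyapunov]
  norm_cast

lemma rpow_three_div_two {B : ℝ} (hB : 0 ≤ B) : B ^ ((3 : ℝ) / 2) = B * √B := by
  rw [show (3 : ℝ) / 2 = 1 + 1 / 2 by norm_num, Real.rpow_add_of_nonneg hB (by norm_num)
    (by norm_num), Real.rpow_one, ← Real.sqrt_eq_rpow]

lemma IsCenteredSequence.le_sumVar [IsProbabilityMeasure P] (h : IsCenteredSequence P X p J)
    (h3 : ∀ i, Integrable (fun ω => |X i ω| ^ 3) P) (n : ℕ) :
    n * envelopeConst J ≤ sumVar P X n := by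
  calc n * envelopeConst J = ∑ i ∈ Finset.range n, envelopeConst J := by simp
    _ ≤ _ := Finset.sum_le_sum fun i _ => h.envelopeConst_le_variance i (h3 i)

lemma IsCenteredSequence.sumVar_le [IsProbabilityMeasure P] (h : IsCenteredSequence P X p J)
    {β : ℝ} (h3 : ∀ i, Integrable (fun ω => |X i ω| ^ 3) P)
    (hβ : ∀ i, ∫ ω, |X i ω| ^ 3 ∂P ≤ β) (n : ℕ) : sumVar P X n ≤ n * (1 + β) := by
  calc _ ≤ ∑ i ∈ Finset.range n, (1 + β) :=
        Finset.sum_le_sum fun i _ => h.variance_le_one_add i (h3 i) (hβ i)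
    _ = _ := by rw [Finset.sum_const, Finset.card_range, nsmul_eq_mul]

lemma IsCenteredSequence.sumVar_pos [IsProbabilityMeasure P] (h : IsCenteredSequence P X p J)
    (h3 : ∀ i, Integrable (fun ω => |X i ω| ^ 3) P) {n : ℕ} (hn : 1 ≤ n) : 0 < sumVar P X n := by
  have h1 : (0 : ℝ) < n := by exact_mod_cast hn
  exact (mul_pos h1 (envelopeConst_pos h.pos)).trans_le (h.le_sumVar h3 n)

/-- The lower bound `1 / √n` on the Lyapunov ratio of order three. -/
lemma IsCenteredSequence.one_div_sqrt_le_lyapunov [IsProbabilityMeasure P]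
    (h : IsCenteredSequence P X p J) (h3 : ∀ i, Integrable (fun ω => |X i ω| ^ 3) P) {n : ℕ}
    (hn : 1 ≤ n) : 1 / √n ≤ lyapunov P X 3 n := by
  have hn0 : (0 : ℝ) < n := by exact_mod_cast hn
  have hB := h.sumVar_pos h3 hn
  rw [lyapunov_three]
  simp only
  set B := sumVar P X n with hBdef
  -- the tangent `(3 s x ^ 2 - s ^ 3) / 2` to `x ^ 3` at the root mean square value `s`
  set s := √(B / n) with hs
  have hs0 : 0 < s := Real.sqrt_pos.2 (by positivity)
  have hs2 : s ^ 2 = B / n := Real.sq_sqrt (by positivity)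
  have hyoung : ∀ i, 3 / 2 * s * variance (X i) P - s ^ 3 / 2 ≤ ∫ ω, |X i ω| ^ 3 ∂P := by
    intro i
    have hsq : Integrable (fun ω => X i ω ^ 2) P := (h.memLp_two h3 i).integrable_sq
    rw [variance_of_integral_eq_zero (h.measurable i).aemeasurable (h.centered i)]
    have e : ∫ ω, (3 / 2 * s * X i ω ^ 2 - s ^ 3 / 2) ∂P
        = 3 / 2 * s * (∫ ω, X i ω ^ 2 ∂P) - s ^ 3 / 2 := by
      rw [integral_sub (hsq.const_mul _) (integrable_const _), integral_const_mul]
      simp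
    refine e.symm.le.trans (integral_mono ((hsq.const_mul _).sub (integrable_const _)) (h3 i)
      fun ω => ?_)
    beta_reduce
    rw [← sq_abs]
    have := abs_nonneg (X i ω)
    nlinarith [mul_nonneg (by positivity : 0 ≤ 2 * |X i ω| + s) (sq_nonneg (|X i ω| - s))]
  have hsum : B * s ≤ ∑ i ∈ Finset.range n, ∫ ω, |X i ω| ^ 3 ∂P := by
    have := Finset.sum_le_sum fun i (_ : i ∈ Finset.range n) => hyoung i
    rw [Finset.sum_sub_distrib, ← Finset.mul_sum] at this
    simp only [Finset.sum_const, Finset.card_range, nsmul_eq_mul] at this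
    have e1 : (n : ℝ) * (s ^ 3 / 2) = B * s / 2 := by
      rw [pow_succ, hs2]; field_simp
    have e2 : ∑ i ∈ Finset.range n, variance (X i) P = B := rfl
    rw [e1, e2] at this
    linarith
  rw [rpow_three_div_two hB.le, div_le_div_iff₀ (Real.sqrt_pos.2 hn0) (by positivity), one_mul]
  have e3 : s * √n = √B := by
    rw [hs, Real.sqrt_div hB.le, div_mul_cancel₀ _ (Real.sqrt_pos.2 hn0).ne']
  calc B * √B = B * s * √n := by rw [mul_assoc, e3]
    _ ≤ _ := by gcongr

lemma IsCenteredSequence.lyapunov_le [IsProbabilityMeasure P] (h : IsCenteredSequence P X p J)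
    {β : ℝ} (h3 : ∀ i, Integrable (fun ω => |X i ω| ^ 3) P)
    (hβ : ∀ i, ∫ ω, |X i ω| ^ 3 ∂P ≤ β) {n : ℕ} (hn : 1 ≤ n) :
    lyapunov P X 3 n ≤ β / (envelopeConst J * √(envelopeConst J)) / √n := by
  have hn0 : (0 : ℝ) < n := by exact_mod_cast hn
  have hκ := envelopeConst_pos h.pos
  have hB := h.le_sumVar h3 n
  have hβ0 : 0 ≤ β := (integral_nonneg fun ω => by positivity).trans (hβ 0)
  rw [lyapunov_three]
  simp only
  have hsum : ∑ i ∈ Finset.range n, ∫ ω, |X i ω| ^ 3 ∂P ≤ n * β :=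
    (Finset.sum_le_sum fun i _ => hβ i).trans_eq (by simp)
  set κ := envelopeConst J
  calc _ ≤ n * β / (n * κ * √(n * κ)) := by
        rw [← rpow_three_div_two (by positivity)]
        gcongr
    _ = _ := by
        rw [Real.sqrt_mul hn0.le]
        have := Real.sqrt_pos.2 hn0
        have := Real.sqrt_pos.2 hκ
        field_simp

/-! ### Reduction to the sum before normalization -/

lemma IsCenteredSequence.variance_sum [IsProbabilityMeasure P] (h : IsCenteredSequence P X p J)
    (h3 : ∀ i, Integrable (fun ω => |X i ω| ^ 3) P) (n : ℕ) :
    variance (fun ω => ∑ i ∈ Finset.range n, X i ω) P = sumVar P X n := by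
  have := IndepFun.variance_sum (s := Finset.range n) (fun i _ => h.memLp_two h3 i)
    (fun i _ j _ hij => h.indep.indepFun hij)
  rw [← sumVar] at this
  rw [← this]
  congr 1
  ext ω
  simp

/-- Normalization does not increase the relative entropy, by the data processing inequality. -/
lemma IsCenteredSequence.divGaussian_le [IsProbabilityMeasure P] (h : IsCenteredSequence P X p J)
    (h3 : ∀ i, Integrable (fun ω => |X i ω| ^ 3) P) {n : ℕ} (hn : 1 ≤ n) :
    divGaussian P (normSum P X n) ≤
      klDiv (P.map (∑ i ∈ Finset.range n, X i)) (gaussianReal 0 (sumVar P X n).toNNReal) := by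
  have hB := h.sumVar_pos h3 hn
  set B := sumVar P X n with hBdef
  have hmean : ∫ ω, normSum P X n ω ∂P = 0 := by
    simp only [normSum]
    rw [integral_div, integral_finsetSum _ fun i _ => (h.memLp_two h3 i).integrable (by norm_num)]
    simp [h.centered]
  have hvar : variance (normSum P X n) P = 1 := by
    have e : normSum P X n = fun ω => (√B)⁻¹ * ∑ i ∈ Finset.range n, X i ω := by
      ext ω; simp only [normSum]; rw [← hBdef]; ring
    rw [e, variance_const_mul, h.variance_sum h3 n, ← hBdef, inv_pow, Real.sq_sqrt hB.le]
    exact inv_mul_cancel₀ hB.ne'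
  have hmap : P.map (normSum P X n) =
      (P.map (∑ i ∈ Finset.range n, X i)).map (fun x => (√B)⁻¹ * x) := by
    rw [Measure.map_map (by fun_prop) (h.measurable_sum n)]
    congr 1
    ext ω
    simp only [normSum, Function.comp, Finset.sum_apply]
    rw [← hBdef]; ring
  have hG : gaussianReal 0 1 = (gaussianReal 0 B.toNNReal).map (fun x => (√B)⁻¹ * x) := by
    rw [gaussianReal_map_const_mul, mul_zero]
    congr 1
    ext
    simp only [NNReal.coe_one, NNReal.coe_mul, NNReal.coe_mk, Real.coe_toNNReal _ hB.le]
    rw [inv_pow, Real.sq_sqrt hB.le, inv_mul_cancel₀ hB.ne']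
  have := Measure.isProbabilityMeasure_map (μ := P) (h.measurable_sum n).aemeasurable
  rw [divGaussian, hmean, hvar, Real.toNNReal_one, hmap, hG]
  exact klDiv_map_le _ _ (by fun_prop)

end

end EntropicCLT

namespace EntropicCLT

open Filter Topology InformationTheory
open scoped Real NNReal ENNReal

/-! ### The entropic bound -/

/-- The total variation bound `T` absorbs a factor logarithmic in `1 / t`: a small power of `t` is
given up for `log (1 / t)`, and `log A ≤ A ^ a / a` for the remaining constant `A`, so that the
final constant does not depend on `A`. -/
lemma entropy_bound_le {T t A y m a a₀ ε : ℝ} (hT0 : 0 ≤ T) (hT2 : T ≤ 2) (hTt : T ≤ t)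
    (ht : 0 < t) (hA : 1 ≤ A) (hy : 0 < y) (hyA : y ≤ A / t) (hm : 1 ≤ m) (ha₀ : 0 < a₀)
    (ha : a₀ ≤ a) (hε : 0 < ε) (haε : a + ε ≤ 1) :
    (1 + max 0 (Real.log y)) * T + T ^ (a + ε) * m ≤
      2 * (2 + 1 / a₀ + 1 / ε) * m * (A * t) ^ a := by
  have ha0 : 0 < a := ha₀.trans_le ha
  have hAa : 1 ≤ A ^ a := Real.one_le_rpow hA ha0.le
  have hta : 0 < t ^ a := Real.rpow_pos_of_pos ht a
  have hlogA : Real.log A ≤ A ^ a / a₀ :=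
    (Real.log_le_rpow_div (by linarith) ha0).trans (by gcongr)
  have hlogA0 : 0 ≤ Real.log A := Real.log_nonneg hA
  have hlog := Real.log_le_log hy hyA
  rw [Real.log_div (by positivity) ht.ne'] at hlog
  rw [Real.mul_rpow (by linarith) ht.le]
  set E := A ^ a * t ^ a with hE
  have hE0 : 0 < E := by positivity
  have htE : t ^ a ≤ E := le_mul_of_one_le_left hta.le hAa
  have key : (1 + max 0 (Real.log y)) * T ≤ 2 * (1 + 1 / a₀ + 1 / ε) * E ∧
      T ^ (a + ε) ≤ 2 * E := by
    rcases le_or_gt 1 t with h1 | h1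
    · have hta1 : 1 ≤ t ^ a := Real.one_le_rpow h1 ha0.le
      have hE1 : A ^ a ≤ E := le_mul_of_one_le_right (by positivity) hta1
      have hmax : max 0 (Real.log y) ≤ 1 / a₀ * E := by
        refine max_le (by positivity) ?_
        have h2 := Real.log_nonneg h1
        calc Real.log y ≤ A ^ a / a₀ := by linarith
          _ = 1 / a₀ * A ^ a := by ring
          _ ≤ _ := by gcongr
      constructor
      · calc (1 + max 0 (Real.log y)) * T ≤ (E + 1 / a₀ * E) * 2 := by
              gcongr
              linarith
          _ = 2 * (1 + 1 / a₀) * E := by ring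
          _ ≤ _ := by
              have : 0 ≤ 1 / ε * E := by positivity
              linarith
      · calc T ^ (a + ε) ≤ 2 ^ (a + ε) := by gcongr
          _ ≤ (2 : ℝ) ^ (1 : ℝ) := Real.rpow_le_rpow_of_exponent_le (by norm_num) haε
          _ ≤ 2 * E := by rw [Real.rpow_one]; linarith
    · have hlt := Real.log_nonpos ht.le h1.le
      have hmax : max 0 (Real.log y) ≤ A ^ a / a₀ - Real.log t :=
        max_le (by linarith [div_nonneg (zero_le_one.trans hAa) ha₀.le]) (by linarith)
      have hlt2 : -Real.log t ≤ t ^ (-ε) / ε := by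
        have := Real.log_le_rpow_div (inv_nonneg.2 ht.le) hε
        rwa [Real.log_inv, Real.inv_rpow ht.le, ← Real.rpow_neg ht.le] at this
      have htta : t ≤ t ^ a := by
        conv_lhs => rw [← Real.rpow_one t]
        exact Real.rpow_le_rpow_of_exponent_ge ht h1.le (by linarith)
      have htt : t * t ^ (-ε) ≤ t ^ a := by
        conv_lhs => rw [← Real.rpow_one_add' ht.le (by linarith)]
        exact Real.rpow_le_rpow_of_exponent_ge ht h1.le (by linarith)
      constructor
      · calc (1 + max 0 (Real.log y)) * T ≤ (1 + (A ^ a / a₀ + t ^ (-ε) / ε)) * t := by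
              gcongr
              linarith
          _ = t + 1 / a₀ * (A ^ a * t) + 1 / ε * (t * t ^ (-ε)) := by ring
          _ ≤ E + 1 / a₀ * E + 1 / ε * E := by
              have h4 : A ^ a * t ≤ E := mul_le_mul_of_nonneg_left htta (by linarith)
              have h5 : t * t ^ (-ε) ≤ E := htt.trans htE
              gcongr
              linarith
          _ ≤ _ := by
              have : 0 ≤ (1 + 1 / a₀ + 1 / ε) * E := by positivity
              linarith
      · calc T ^ (a + ε) ≤ t ^ (a + ε) := by gcongr
          _ ≤ t ^ a := Real.rpow_le_rpow_of_exponent_ge ht h1.le (by linarith)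
          _ ≤ 2 * E := by linarith
  have k2 := mul_le_mul_of_nonneg_right key.2 (zero_le_one.trans hm)
  have k3 : 2 * (1 + 1 / a₀ + 1 / ε) * E ≤ 2 * (1 + 1 / a₀ + 1 / ε) * E * m :=
    le_mul_of_one_le_right (by positivity) hm
  linarith [key.1]

/-- The constant `C (J, M)` of the entropic bound, with `1 + M` bounding the third absolute
moments of the summands. -/
noncomputable def entropicConst (J M : ℝ) : ℝ :=
  max 1 (max 1 (√(2 * π * J * (1 + (1 + M))) *
    ((1 + M) / (envelopeConst J * √(envelopeConst J))) * sumConst J (1 + M)) *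
      sumConst J (1 + M))

lemma entropicConst_pos (J M : ℝ) : 0 < entropicConst J M := zero_lt_one.trans_le (le_max_left _ _)

section

variable {Ω : Type*} [MeasurableSpace Ω] {P : Measure Ω} [IsProbabilityMeasure P]
  {X : ℕ → Ω → ℝ} {p : ℕ → ℝ → ℝ} {J M k : ℝ}

lemma IsCenteredSequence.divGaussian_normSum_le (h : IsCenteredSequence P X p J)
    (hM : MomentBound P X k M) {k₀ ε : ℝ} (hk₀ : 3 ≤ k₀) (hε : 0 < ε) (hεk : ε < 1 - 2 / k₀)
    (hk : k₀ ≤ k) {n : ℕ} (hn : 1 ≤ n) :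
    divGaussian P (normSum P X n) ≤
      ENNReal.ofReal (2 * (2 + 1 / (1 - 2 / k₀ - ε) + 1 / ε) * normMoment P X k n ^ (2 / k) *
        (entropicConst J M * lyapunov P X 3 n) ^ (1 - 2 / k - ε)) := by
  have hk3 : 3 ≤ k := hk₀.trans hk
  have hk0 : 0 < k := by linarith
  have hkk : 2 / k ≤ 2 / k₀ := by gcongr
  have h2k : 0 < 2 / k := by positivity
  have h3 := hM.integrable_abs_pow_three h.measurable hk3
  have hβ := hM.integral_abs_pow_three_le h.measurable hk3
  have hβ0 : 0 ≤ 1 + M := by linarith [hM.nonneg]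
  set β := 1 + M with hβdef
  have hn0 : (0 : ℝ) < n := by exact_mod_cast hn
  have hsn : 0 < √(n : ℝ) := Real.sqrt_pos.2 hn0
  have hJ := h.pos
  have hκ := envelopeConst_pos hJ
  have hB := h.sumVar_pos h3 hn
  have hBn := h.sumVar_le h3 hβ n
  have hL1 := h.one_div_sqrt_le_lyapunov h3 hn
  have hL2 := h.lyapunov_le h3 hβ hn
  have hc0 := sumConst_pos hJ hβ0
  have hconst : entropicConst J M = max 1 (max 1 (√(2 * π * J * (1 + β)) *
    (β / (envelopeConst J * √(envelopeConst J))) * sumConst J β) * sumConst J β) := rfl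
  set L := lyapunov P X 3 n with hL
  set c₀ := sumConst J β with hc₀
  set c₂ := β / (envelopeConst J * √(envelopeConst J)) with hc₂
  set D := √(2 * π * J * (1 + β)) with hD
  set A := max 1 (D * c₂ * c₀) with hA
  have hL0 : 0 < L := (by positivity : 0 < 1 / √(n : ℝ)).trans_le hL1
  obtain ⟨q, hq, hq0, hqb, hS⟩ := h.exists_density_sum hn
  obtain ⟨hT2, hTn⟩ := h.integral_abs_sub_le h3 hβ hn hq hq0 hS
  have hms := h.measurable_sum n
  have hSp := Measure.isProbabilityMeasure_map (μ := P) hms.aemeasurable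
  have hmeas : Measurable fun x : ℝ => |x| ^ k := by fun_prop
  have hmom : ∫ ω, |∑ i ∈ Finset.range n, X i ω| ^ k ∂P = ∫ x, |x| ^ k * q x := by
    have e := integral_map (μ := P) hms.aemeasurable (f := fun x : ℝ => |x| ^ k)
      hmeas.aestronglyMeasurable
    simp only [Finset.sum_apply] at e
    rw [← e, hS, integral_withDensity_ofReal hq.measurable hq0]
    simp only [smul_eq_mul, mul_comm]
  have hsqi : ∫ x, x ^ 2 * q x = sumVar P X n := by
    have e := integral_map (μ := P) hms.aemeasurable (f := fun x : ℝ => x ^ 2) (by fun_prop)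
    simp only [Finset.sum_apply] at e
    rw [← h.variance_sum h3 n, variance_of_integral_eq_zero, ← e, hS,
      integral_withDensity_ofReal hq.measurable hq0]
    · simp only [smul_eq_mul, mul_comm]
    · have := hms.aemeasurable (μ := P)
      convert this using 1
      ext ω; simp
    · rw [integral_finsetSum _ fun i _ => (h.memLp_two h3 i).integrable (by norm_num)]
      simp [h.centered]
  have hik : Integrable fun x => |x| ^ k * q x := by
    have e : Integrable (fun x : ℝ => |x| ^ k) (P.map (∑ i ∈ Finset.range n, X i)) := by
      rw [integrable_map_measure hmeas.aestronglyMeasurable hms.aemeasurable]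
      have := hM.integrable_abs_sum_rpow h.measurable hk3 n
      convert this using 1
      ext ω; simp
    rw [hS, integrable_withDensity_iff (by fun_prop) (by simp)] at e
    simpa [hq0] using e
  have hdiv := h.divGaussian_le h3 hn
  rw [hS] at hdiv hSp
  have hv : (sumVar P X n).toNNReal ≠ 0 := by simpa using hB
  have hvB : ((sumVar P X n).toNNReal : ℝ) = sumVar P X n := Real.coe_toNNReal _ hB.le
  have hkl := klDiv_gaussianReal_le hq hq0 hqb hv (k := k) (by linarith) hik rfl
  rw [hvB, ← hmom] at hkl
  refine hdiv.trans (hkl.trans (ENNReal.ofReal_le_ofReal ?_))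
  set B := sumVar P X n with hBdef
  set T := ∫ x, |q x - gaussianPDFReal 0 B.toNNReal x| with hT
  have hnm : (∫ ω, |∑ i ∈ Finset.range n, X i ω| ^ k ∂P) / B ^ (k / 2) = normMoment P X k n := rfl
  rw [hnm]
  have hm1 : 1 ≤ normMoment P X k n ^ (2 / k) := by
    have e1 := integral_sq_mul_le hq hq0 (integrable_of_withDensity hq hq0) (by linarith) hik
    rw [integral_eq_one_of_withDensity hq hq0, Real.one_rpow, one_mul, hsqi, ← hmom] at e1
    have e3 : (B ^ (k / 2)) ^ (2 / k) = B := by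
      rw [← Real.rpow_mul hB.le, show k / 2 * (2 / k) = 1 by field_simp, Real.rpow_one]
    have e4 : 0 ≤ ∫ ω, |∑ i ∈ Finset.range n, X i ω| ^ k ∂P :=
      integral_nonneg fun ω => Real.rpow_nonneg (abs_nonneg _) k
    rw [← hnm, Real.div_rpow e4 (by positivity), e3]
    exact (one_le_div hB).2 e1
  have hTt : T ≤ c₀ * L := by
    refine hTn.trans ?_
    rw [div_eq_mul_one_div]
    gcongr
  have hsnL : √(n : ℝ) ≤ c₂ / L := by
    rw [le_div_iff₀ hL0]
    rwa [le_div_iff₀ hsn, mul_comm] at hL2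
  have hy : √J * √(2 * π * B) ≤ A / (c₀ * L) := by
    calc √J * √(2 * π * B) = √(J * (2 * π * B)) := (Real.sqrt_mul hJ.le _).symm
      _ ≤ √(2 * π * J * (1 + β) * n) := by
          refine Real.sqrt_le_sqrt ?_
          have := mul_le_mul_of_nonneg_left hBn (by positivity : 0 ≤ 2 * π * J)
          linarith
      _ = D * √n := by rw [Real.sqrt_mul (by positivity)]
      _ ≤ D * (c₂ / L) := by gcongr
      _ = D * c₂ * c₀ / (c₀ * L) := by field_simp
      _ ≤ _ := by gcongr; exact le_max_right _ _
  have hfin := entropy_bound_le (T := T) (t := c₀ * L) (A := A) (y := √J * √(2 * π * B))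
    (m := normMoment P X k n ^ (2 / k)) (a := 1 - 2 / k - ε) (a₀ := 1 - 2 / k₀ - ε) (ε := ε)
    (integral_nonneg fun x => abs_nonneg _) hT2 hTt (by positivity) (le_max_left _ _)
    (by have := Real.sqrt_pos.2 hJ; positivity) hy hm1 (by linarith) (by linarith) hε (by linarith)
  rw [sub_add_cancel] at hfin
  refine hfin.trans ?_
  have h0 : 0 < 1 - 2 / k₀ - ε := by linarith
  have hAC : A * (c₀ * L) ≤ entropicConst J M * L := by
    rw [hconst, ← mul_assoc]
    gcongr
    exact le_max_right _ _
  have ha : 0 ≤ 1 - 2 / k - ε := by linarith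
  gcongr

/-! ### The fourth moment of the sum -/

lemma integrable_pow_of_integrable_pow_four {Y : Ω → ℝ} (hY : Measurable Y)
    (h4 : Integrable (fun ω => Y ω ^ 4) P) {j : ℕ} (hj : j ≤ 4) :
    Integrable (fun ω => Y ω ^ j) P := by
  refine ((integrable_const 1).add h4).mono' (by fun_prop) (ae_of_all _ fun ω => ?_)
  rw [norm_pow, Real.norm_eq_abs]
  simp only [Pi.add_apply]
  rw [← Even.pow_abs (by decide : Even 4)]
  rcases le_total |Y ω| 1 with h | h
  · have := pow_le_one₀ (n := j) (abs_nonneg (Y ω)) h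
    have : 0 ≤ |Y ω| ^ 4 := by positivity
    linarith
  · have := pow_le_pow_right₀ h hj
    linarith

lemma integral_add_pow_four {Y Z : Ω → ℝ} (hY : Measurable Y) (hZ : Measurable Z)
    (hYZ : IndepFun Y Z P) (hY4 : Integrable (fun ω => Y ω ^ 4) P)
    (hZ4 : Integrable (fun ω => Z ω ^ 4) P) (hY0 : ∫ ω, Y ω ∂P = 0) (hZ0 : ∫ ω, Z ω ∂P = 0) :
    Integrable (fun ω => (Y ω + Z ω) ^ 4) P ∧
    ∫ ω, (Y ω + Z ω) ^ 4 ∂P = ∫ ω, Y ω ^ 4 ∂P + 6 * ((∫ ω, Y ω ^ 2 ∂P) * ∫ ω, Z ω ^ 2 ∂P) +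
      ∫ ω, Z ω ^ 4 ∂P := by
  have hi : ∀ i ≤ 4, ∀ j ≤ 4, Integrable (fun ω => Y ω ^ i * Z ω ^ j) P ∧
      ∫ ω, Y ω ^ i * Z ω ^ j ∂P = (∫ ω, Y ω ^ i ∂P) * ∫ ω, Z ω ^ j ∂P := by
    intro i hi j hj
    have hind : IndepFun (fun ω => Y ω ^ i) (fun ω => Z ω ^ j) P :=
      hYZ.comp (φ := fun x => x ^ i) (ψ := fun x => x ^ j) (by fun_prop) (by fun_prop)
    exact ⟨hind.integrable_mul (integrable_pow_of_integrable_pow_four hY hY4 hi)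
      (integrable_pow_of_integrable_pow_four hZ hZ4 hj),
      hind.integral_fun_mul_eq_mul_integral (by fun_prop) (by fun_prop)⟩
  obtain ⟨i31, e31⟩ := hi 3 (by norm_num) 1 (by norm_num)
  obtain ⟨i22, e22⟩ := hi 2 (by norm_num) 2 (by norm_num)
  obtain ⟨i13, e13⟩ := hi 1 (by norm_num) 3 (by norm_num)
  have hexp : (fun ω => (Y ω + Z ω) ^ 4) = fun ω => Y ω ^ 4 + (4 * (Y ω ^ 3 * Z ω ^ 1) +
      (6 * (Y ω ^ 2 * Z ω ^ 2) + (4 * (Y ω ^ 1 * Z ω ^ 3) + Z ω ^ 4))) := by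
    ext ω; ring
  have j1 : Integrable (fun ω => 4 * (Y ω ^ 1 * Z ω ^ 3) + Z ω ^ 4) P := (i13.const_mul 4).add hZ4
  have j2 : Integrable (fun ω => 6 * (Y ω ^ 2 * Z ω ^ 2) +
    (4 * (Y ω ^ 1 * Z ω ^ 3) + Z ω ^ 4)) P := (i22.const_mul 6).add j1
  have j3 : Integrable (fun ω => 4 * (Y ω ^ 3 * Z ω ^ 1) + (6 * (Y ω ^ 2 * Z ω ^ 2) +
    (4 * (Y ω ^ 1 * Z ω ^ 3) + Z ω ^ 4))) P := (i31.const_mul 4).add j2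
  rw [hexp]
  refine ⟨hY4.add j3, ?_⟩
  rw [integral_add hY4 j3, integral_add (i31.const_mul 4) j2, integral_add (i22.const_mul 6) j1,
    integral_add (i13.const_mul 4) hZ4, integral_const_mul, integral_const_mul,
    integral_const_mul, e31, e22, e13]
  simp only [pow_one, hY0, hZ0]
  ring

lemma IsCenteredSequence.integral_sum_pow_four_le (h : IsCenteredSequence P X p J)
    (h3 : ∀ i, Integrable (fun ω => |X i ω| ^ 3) P)
    (h4 : ∀ i, Integrable (fun ω => X i ω ^ 4) P) (n : ℕ) :
    Integrable (fun ω => (∑ i ∈ Finset.range n, X i ω) ^ 4) P ∧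
    ∫ ω, (∑ i ∈ Finset.range n, X i ω) ^ 4 ∂P ≤
      ∑ i ∈ Finset.range n, ∫ ω, X i ω ^ 4 ∂P + 3 * sumVar P X n ^ 2 := by
  induction n with
  | zero => simp [sumVar]
  | succ n ih =>
    have hm : Measurable fun ω => ∑ i ∈ Finset.range n, X i ω :=
      Finset.measurable_sum _ fun i _ => h.measurable i
    have hmean : ∫ ω, ∑ i ∈ Finset.range n, X i ω ∂P = 0 := by
      rw [integral_finsetSum _ fun i _ => (h.memLp_two h3 i).integrable (by norm_num)]
      simp [h.centered]
    have hind : IndepFun (fun ω => ∑ i ∈ Finset.range n, X i ω) (X n) P := by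
      convert h.indep.indepFun_sum_range_succ h.measurable n using 1
      ext ω; simp
    have hvS := h.variance_sum h3 n
    rw [variance_of_integral_eq_zero hm.aemeasurable hmean] at hvS
    have hvX := variance_of_integral_eq_zero (h.measurable n).aemeasurable (h.centered n)
    obtain ⟨k1, k2⟩ := integral_add_pow_four hm (h.measurable n) hind ih.1 (h4 n) hmean
      (h.centered n)
    have hsucc : sumVar P X (n + 1) = sumVar P X n + variance (X n) P := by
      simp only [sumVar, Finset.sum_range_succ]
    simp_rw [Finset.sum_range_succ]
    refine ⟨k1, ?_⟩
    rw [k2, hvS, ← hvX, hsucc]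
    nlinarith [ih.2, sq_nonneg (variance (X n) P)]

lemma IsCenteredSequence.normMoment_four_le (h : IsCenteredSequence P X p J)
    (hM : MomentBound P X 4 M) {n : ℕ} (hn : 1 ≤ n) :
    normMoment P X 4 n ≤ lyapunov P X 4 n + 3 := by
  have h3 := hM.integrable_abs_pow_three h.measurable (by norm_num)
  have hB := h.sumVar_pos h3 hn
  have hpow : ∀ x : ℝ, |x| ^ (4 : ℝ) = x ^ 4 := fun x => by
    rw [show (4 : ℝ) = ((4 : ℕ) : ℝ) by norm_num, Real.rpow_natCast,
      Even.pow_abs (by decide : Even 4)]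
  have h4 : ∀ i, Integrable (fun ω => X i ω ^ 4) P := fun i => by
    simpa only [hpow] using (hM i).1
  have hB2 : sumVar P X n ^ ((4 : ℝ) / 2) = sumVar P X n ^ 2 := by
    rw [show (4 : ℝ) / 2 = ((2 : ℕ) : ℝ) by norm_num, Real.rpow_natCast]
  simp only [normMoment, lyapunov, hpow, hB2]
  rw [div_add' _ _ _ (by positivity)]
  gcongr
  exact (h.integral_sum_pow_four_le h3 h4 n).2

end

end EntropicCLT

theorem mainTheorem2 :
    ∃ C : ℝ → ℝ → ℝ, (∀ J M, 0 < C J M) ∧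
      (∀ k₀ ε : ℝ, 3 ≤ k₀ → 0 < ε → ε < 1 / 2 → ε < 1 - 2 / k₀ →
        ∃ C₁ : ℝ, 0 < C₁ ∧
          ∀ (k : ℝ) (_ : k₀ ≤ k) (J M : ℝ)
            (Ω : Type u) [MeasurableSpace Ω] (P : Measure Ω) [IsProbabilityMeasure P]
            (X : ℕ → Ω → ℝ) (p : ℕ → ℝ → ℝ),
            EntropicCLT.IsCenteredSequence P X p J → EntropicCLT.MomentBound P X k M →
            ∀ n : ℕ, 1 ≤ n →
              EntropicCLT.divGaussian P (EntropicCLT.normSum P X n) ≤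
                ENNReal.ofReal (C₁ * EntropicCLT.normMoment P X k n ^ (2 / k) *
                  (C J M * EntropicCLT.lyapunov P X 3 n) ^ (1 - 2 / k - ε))) ∧
      (∀ ε : ℝ, 0 < ε → ε < 1 / 2 →
        ∃ C₁ : ℝ, 0 < C₁ ∧
          ∀ (J M : ℝ)
            (Ω : Type u) [MeasurableSpace Ω] (P : Measure Ω) [IsProbabilityMeasure P]
            (X : ℕ → Ω → ℝ) (p : ℕ → ℝ → ℝ),
            EntropicCLT.IsCenteredSequence P X p J → EntropicCLT.MomentBound P X 4 M →
            ∀ n : ℕ, 1 ≤ n →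
              EntropicCLT.divGaussian P (EntropicCLT.normSum P X n) ≤
                ENNReal.ofReal (C₁ *
                  (C J M * EntropicCLT.lyapunov P X 3 n) ^ (1 / 2 - ε) *
                  √(EntropicCLT.lyapunov P X 4 n + 3))) := by
  refine ⟨EntropicCLT.entropicConst, EntropicCLT.entropicConst_pos, ?_, ?_⟩
  · intro k₀ ε hk₀ hε _ hεk
    have h0 : 0 < 1 - 2 / k₀ - ε := by linarith
    refine ⟨2 * (2 + 1 / (1 - 2 / k₀ - ε) + 1 / ε), by positivity, ?_⟩
    intro k hk J M Ω _ P _ X p h hM n hn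
    exact h.divGaussian_normSum_le hM hk₀ hε hεk hk hn
  · intro ε hε hε2
    have h0 : 0 < 1 - 2 / (4 : ℝ) - ε := by linarith
    refine ⟨2 * (2 + 1 / (1 - 2 / (4 : ℝ) - ε) + 1 / ε), by positivity, ?_⟩
    intro J M Ω _ P _ X p h hM n hn
    refine (h.divGaussian_normSum_le hM (by norm_num) hε (by linarith) le_rfl hn).trans
      (ENNReal.ofReal_le_ofReal ?_)
    have hL : 0 < EntropicCLT.lyapunov P X 3 n :=
      (by have : (0 : ℝ) < n := by exact_mod_cast hn
          positivity : 0 < 1 / √(n : ℝ)).trans_le (h.one_div_sqrt_le_lyapunov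
        (hM.integrable_abs_pow_three h.measurable (by norm_num)) hn)
    have hC := EntropicCLT.entropicConst_pos J M
    have e1 : (1 : ℝ) - 2 / 4 - ε = 1 / 2 - ε := by norm_num
    have e2 : EntropicCLT.normMoment P X 4 n ^ ((2 : ℝ) / 4) ≤
        √(EntropicCLT.lyapunov P X 4 n + 3) := by
      rw [show (2 : ℝ) / 4 = 1 / 2 by norm_num, ← Real.sqrt_eq_rpow]
      exact Real.sqrt_le_sqrt (h.normMoment_four_le hM hn)
    have h1 : 0 < 1 / 2 - ε := by linarith
    rw [e1, mul_right_comm]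
    gcongr
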